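/- Let $\mathbb K$ be a field, $R=\mathbb K[x_0,\dots,x_n]$ with $x_0<\dots<x_n$, and, for a Noetherian (commutative) $\mathbb K$-algebra $A$, let $R_A=A[x_0,\dots,x_n]$ with the standard grading. Let $\boldsymbol d\in\mathbb Z^m$ and let $R_A^m(-\boldsymbol d)$ be the graded free module with basis elements $\mathsf e_k$ of degree $d_k$. A variable $x_i$ is multiplicative for a term $x^\alpha\mathsf e_k$ if $x_i\le\min(x^\alpha)$ (all variables are multiplicative if $x^\alpha=1$). The Pommaret cone of $x^\alpha \mathsf e_k$ is the set of the terms $x^\delta x^\alpha\mathsf e_k$ with $x^\delta$ a product of multiplicative variables. Let $U\subseteq R^m(-\boldsymbol d)$ be a quasi-stable module: a monomial submodule generated by a finite set $\mathcal P_U$ of terms (its Pommaret basis) such that the set of terms of $U$ is the disjoint union of the Pommaret cones of the elements of $\mathcal P_U$. Let $\mathcal N(U)$ be the set of terms not in $U$, and $\langle\mathcal N(U)\rangle$ the $A$-module it generates. A $U$-marked set over $A$ is a family $F=(f_{\tau})_{\tau\in\mathcal P_U}$ of homogeneous elements of $R_A^m(-\boldsymbol d)$, where $f_\tau$ has degree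 $\deg\tau$, the coefficient of $\tau$ in $f_\tau$ is $1$ and all other terms of $f_\tau$ are in $\mathcal N(U)$. It is a $U$-marked basis if $(R_A^m(-\boldsymbol d))_s=(F)_s\oplus\langle\mathcal N(U)_s\rangle$ for all $s$. Its syzygies are the elements of the kernel of $\partial_0:\bigoplus_{\tau\in\mathcal P_U}R_A\mathsf f_\tau\to R_A^m$, $\mathsf f_\tau\mapsto f_\tau$, where $\mathsf f_\tau$ has degree $\deg\tau$. For $\tau\in\mathcal P_U$ and $x_i$ non-multiplicative for $\tau$, the fundamental syzygy of a $U$-marked basis $F$ with head term $x_i\mathsf f_\tau$ is $x_i\mathsf f_\tau-\sum_\gamma P_\gamma\mathsf f_\gamma$, where $x_if_\tau=\sum_{\gamma\in\mathcal P_U}P_\gamma f_\gamma$ and every $P_\gamma$ involves only multiplicative variables of $\gamma$. The $U$-marked functor $\underline{\mathbf{Mf}}_U$ sends a Noetherian $\mathbb K$-algebra $A$ to the set of graded submodules $M\subseteq R_A^m(-\boldsymbol d)$ with $M\oplus\langle\mathcal N(U)\rangle=R_A^m(-\boldsymbol d)$. The $U$-marked syzygy functor sends $A$ to the set of pairs $(M,S_1)$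 with $M\in\underline{\mathbf{Mf}}_U(A)$ and $S_1$ the syzygy module of the $U$-marked basis that generates $M$. Both act on morphisms by extension of scalars. Let $C$ be the set of parameters $C_{\tau,\sigma}$ with $\tau\in\mathcal P_U$, $\sigma\in\mathcal N(U)$, $\deg\sigma=\deg\tau$, and let $\mathcal F$ be the generic marked set, consisting of $F_\tau=\tau-\sum_\sigma C_{\tau,\sigma}\,\sigma$. Let $\mathscr U\subseteq\mathbb K[C]$ be the ideal generated by the coefficients of the normal forms $g$ of the elements $x_iF_\tau$, for $\tau\in\mathcal P_U$ and $x_i$ non-multiplicative for $\tau$; here $g\in\langle\mathcal N(U)\rangle$ is given by the unique writing $x_iF_\tau=\sum_\gamma P_\gamma F_\gamma+g$ with every $P_\gamma$ in the multiplicative variables of $\gamma$. Let $\mathbf{Mf}_U=\operatorname{Spec}(\mathbb K[C]/\mathscr U)$. Let $U^{(1)}\subseteq\bigoplus_\tau R\,\mathsf f_\tau$ be generated by the terms $x_i\mathsf f_\tau$ with $x_i$ non-multiplicative for $\tau$. For such $(i,\tau)$ let $\mathsf s_{i,\tau}$ be the set of the terms $x^\eta\mathsf f_\gamma\notin U^{(1)}$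 of degree $\deg\tau+1$ such that $x^\eta$ is a product of variables that are smaller than $x_i$ and multiplicative for $\gamma$. Let $B$ be the set of parameters $B_{i,\tau,\eta,\gamma}$ with $x^\eta\mathsf f_\gamma\in\mathsf s_{i,\tau}$. The generic fundamental pre-syzygies are $x_i\mathsf f_\tau-\sum_{x^\eta\mathsf f_\gamma\in\mathsf s_{i,\tau}}B_{i,\tau,\eta,\gamma}\,x^\eta\mathsf f_\gamma$. Let $\mathscr S\subseteq\mathbb K[B,C]$ be the ideal generated by the coefficients of the terms in the elements $x_iF_\tau-\sum B_{i,\tau,\eta,\gamma}\,x^\eta F_\gamma$ obtained by substituting $\mathcal F$. Let $M_0$ and $M_1$ be the matrices whose columns are, respectively, the elements of $\mathcal F$ and the generic fundamental pre-syzygies. Then: (1) $\underline{\mathbf{Mf}}_U$ and the $U$-marked syzygy functor are functors on Noetherian $\mathbb K$-algebras, and the $U$-marked syzygy functor is represented by $\operatorname{Spec}(\mathbb K[B,C]/\mathscr S)$: an $A$-point, that is, a $\mathbb K$-algebra homomorphism $\varphi:\mathbb K[B,C]/\mathscr S\to A$, corresponds to the pair of the submodules generated by $\varphi(\mathcal F)$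 and by the images under $\varphi$ of the generic fundamental pre-syzygies. (2) $\mathscr S$ is the ideal generated by the coefficients of the entries of $M_0M_1$. For every Noetherian $\mathbb K$-algebra $A$ and every $\mathbb K$-algebra homomorphism $\varphi:\mathbb K[B,C]\to A$, the following are equivalent: $\mathscr S\subseteq\ker\varphi$; $\varphi(M_0)\varphi(M_1)=0$; $\varphi(\mathcal F)$ is a $U$-marked basis and the images under $\varphi$ of the generic fundamental pre-syzygies are its fundamental syzygies. (3) $\mathscr S\cap\mathbb K[C]=\mathscr U$, and the projection $\mathbb A^{|C\cup B|}\to\mathbb A^{|C|}$ to the $C$-coordinates restricts to an isomorphism $\operatorname{Spec}(\mathbb K[B,C]/\mathscr S)\to\mathbf{Mf}_U$ of $\mathbb K$-schemes. The scheme $\mathbf{Mf}_U$ represents $\underline{\mathbf{Mf}}_U$, a $\mathbb K$-algebra homomorphism $\psi:\mathbb K[C]/\mathscr U\to A$ corresponding to the submodule generated by $\psi(\mathcal F)$, and the isomorphism corresponds to $(M,S_1)\mapsto M$. -/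

import Mathlib

open CategoryTheory AlgebraicGeometry Opposite

universe u

namespace MarkedSyz

noncomputable section

/-! ### Terms, monomial modules and Pommaret bases

The variables `x_0 < ... < x_n` are indexed by `Fin (n + 1)`. The free module `R_A ^ ι` over
`R_A = A[x_0, ..., x_n]` has its basis indexed by a type `ι`; it is `Fin m` for the ambient module
and the Pommaret basis of `U` for the module in which the syzygies live. -/

/-- Exponents `α` of power products `x ^ α`. -/
abbrev Mon (n : ℕ) : Type := Fin (n + 1) →₀ ℕ

/-- Terms `x ^ α e_k` of the free module with basis indexed by `ι`. -/
abbrev Term (n : ℕ) (ι : Type) : Type := Mon n × ι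

/-- The polynomial ring `R_A = A[x_0, ..., x_n]`. -/
abbrev PolyRing (n : ℕ) (A : Type u) [CommRing A] : Type u := MvPolynomial (Fin (n + 1)) A

/-- The free module `R_A ^ ι`. -/
abbrev Vec (n : ℕ) (ι : Type) (A : Type u) [CommRing A] : Type u := ι → PolyRing n A

/-- The term `x ^ α e_k` as an element of `R_A ^ ι`. -/
def termVec {n : ℕ} {ι : Type} [DecidableEq ι] (A : Type u) [CommRing A] (t : Term n ι) :
    Vec n ι A :=
  Pi.single t.2 (MvPolynomial.monomial t.1 1)

/-- The coefficient in `f` of the term `t`. -/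
def coeffAt {n : ℕ} {ι : Type} {A : Type u} [CommRing A] (t : Term n ι) (f : Vec n ι A) : A :=
  (f t.2).coeff t.1

/-- The degree of a term, where the basis element `e_k` has degree `d k`. -/
def tdeg {n : ℕ} {ι : Type} (d : ι → ℤ) (t : Term n ι) : ℤ := (t.1.degree : ℤ) + d t.2

/-- `x_i` is a multiplicative variable of `x ^ α`: `x_i ≤ min (x ^ α)`.
All variables are multiplicative for the term `1`. -/
def IsMult {n : ℕ} (α : Mon n) (i : Fin (n + 1)) : Prop := ∀ j, α j ≠ 0 → i ≤ j

/-- The power products in the multiplicative variables of `x ^ α`. -/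
def multipliers {n : ℕ} (α : Mon n) : Set (Mon n) := {δ | ∀ j, δ j ≠ 0 → IsMult α j}

/-- The power products in the multiplicative variables of `x ^ α` that are smaller than `x_i`.
The `i`-sliced Pommaret cone of `x ^ α` consists of their products with `x ^ α`. -/
def slicedMultipliers {n : ℕ} (i : Fin (n + 1)) (α : Mon n) : Set (Mon n) :=
  {δ | ∀ j, δ j ≠ 0 → j < i ∧ IsMult α j}

/-- The Pommaret cone of a term. -/
def pommaretCone {n : ℕ} {ι : Type} (t : Term n ι) : Set (Term n ι) :=
  {s | ∃ δ ∈ multipliers t.1, s = (δ + t.1, t.2)}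

/-- The finite set `P` is the Pommaret basis of `U`: the terms in `P` generate `U`, and the terms
of `U` are the disjoint union of the Pommaret cones of the terms in `P`. A quasi-stable module is
a submodule with such a `P`, which is then unique. -/
structure IsPommaretBasis {n : ℕ} {ι : Type} [DecidableEq ι] {K : Type u} [Field K]
    (U : Submodule (PolyRing n K) (Vec n ι K)) (P : Finset (Term n ι)) : Prop where
  span_eq : Submodule.span (PolyRing n K) (termVec K '' (P : Set (Term n ι))) = U
  iUnion_cone : {t : Term n ι | termVec K t ∈ U} = ⋃ t ∈ P, pommaretCone t
  disjoint_cone : (P : Set (Term n ι)).PairwiseDisjoint pommaretCone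

/-- `N(U)`, the set of terms that are not in `U`. -/
def sousEscalier {n : ℕ} {ι : Type} [DecidableEq ι] {K : Type u} [Field K]
    (U : Submodule (PolyRing n K) (Vec n ι K)) : Set (Term n ι) :=
  {t | termVec K t ∉ U}

/-! ### Graded submodules of `R_A ^ ι` -/

/-- The `A`-module of the homogeneous elements of degree `s` in `R_A ^ ι(-d)`. -/
def degPiece {n : ℕ} {ι : Type} (A : Type u) [CommRing A] (d : ι → ℤ) (s : ℤ) :
    Submodule A (Vec n ι A) where
  carrier := {f | ∀ t : Term n ι, coeffAt t f ≠ 0 → tdeg d t = s}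
  zero_mem' t ht := by simp [coeffAt] at ht
  add_mem' {f g} hf hg t ht := by
    by_cases h : coeffAt t f = 0
    · refine hg t fun h' => ht ?_
      simp only [coeffAt] at h h'
      simp [coeffAt, h, h']
    · exact hf t h
  smul_mem' a f hf t ht := by
    refine hf t fun h => ht ?_
    simp only [coeffAt] at h
    simp [coeffAt, h]

/-- A graded submodule is one generated by homogeneous elements. -/
def IsGraded {n : ℕ} {ι : Type} {A : Type u} [CommRing A] (d : ι → ℤ)
    (M : Submodule (PolyRing n A) (Vec n ι A)) : Prop :=
  Submodule.span (PolyRing n A) {f | f ∈ M ∧ ∃ s : ℤ, f ∈ degPiece A d s} = M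

/-- The `A`-module `⟨T⟩` generated by a set `T` of terms. -/
def termSpan {n : ℕ} {ι : Type} [DecidableEq ι] (A : Type u) [CommRing A] (T : Set (Term n ι)) :
    Submodule A (Vec n ι A) :=
  Submodule.span A (termVec A '' T)

/-! ### Marked sets, marked bases, syzygies -/

section marked

variable {n m : ℕ} {K : Type u} [Field K] {A : Type u} [CommRing A]

/-- A `U`-marked set, given as a family indexed by the Pommaret basis `P` of `U`: `F t` has head
term `t` with coefficient `1`, is homogeneous, and its other terms are in `N(U)`. -/
def IsMarkedSet (d : Fin m → ℤ) (U : Submodule (PolyRing n K) (Vec n (Fin m) K))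
    (P : Finset (Term n (Fin m))) (F : P → Vec n (Fin m) A) : Prop :=
  ∀ t : P, coeffAt t.1 (F t) = 1 ∧ F t ∈ degPiece A d (tdeg d t.1) ∧
    ∀ s, s ≠ t.1 → coeffAt s (F t) ≠ 0 → s ∈ sousEscalier U

/-- A `U`-marked basis: in every degree `s`, `(R_A ^ m(-d))_s = (F)_s ⊕ ⟨N(U)_s⟩`. -/
def IsMarkedBasis (d : Fin m → ℤ) (U : Submodule (PolyRing n K) (Vec n (Fin m) K))
    (P : Finset (Term n (Fin m))) (F : P → Vec n (Fin m) A) : Prop :=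
  IsMarkedSet d U P F ∧ ∀ s : ℤ,
    ((Submodule.span (PolyRing n A) (Set.range F)).restrictScalars A ⊓ degPiece A d s) ⊔
        termSpan A {t | t ∈ sousEscalier U ∧ tdeg d t = s} = degPiece A d s ∧
      Disjoint ((Submodule.span (PolyRing n A) (Set.range F)).restrictScalars A ⊓ degPiece A d s)
        (termSpan A {t | t ∈ sousEscalier U ∧ tdeg d t = s})

/-- The morphism `∂₀` that sends the basis element `f_t` to `F t`. -/
def partialZero {P : Finset (Term n (Fin m))} (F : P → Vec n (Fin m) A) :
    Vec n P A →ₗ[PolyRing n A] Vec n (Fin m) A :=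
  Fintype.linearCombination (PolyRing n A) F

/-- The module of syzygies of `F`. -/
def syz {P : Finset (Term n (Fin m))} (F : P → Vec n (Fin m) A) :
    Submodule (PolyRing n A) (Vec n P A) :=
  LinearMap.ker (partialZero F)

/-- The pairs `(x ^ α e_k, x_i)` of an element of `P` and one of its non-multiplicative variables.
They index the Pommaret basis `{x_i f_{α,k}}` of `U⁽¹⁾`, the fundamental syzygies and the
fundamental pre-syzygies. -/
abbrev NonMult (P : Finset (Term n (Fin m))) : Type :=
  {p : P × Fin (n + 1) // ¬ IsMult p.1.1.1 p.2}

/-- A family of polynomials `Q γ`, for `γ ∈ P`, in which all terms of `Q γ` are products of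
multiplicative variables of `γ`. -/
def IsMultFamily {P : Finset (Term n (Fin m))} (Q : Vec n P A) : Prop :=
  ∀ γ : P, ∀ η ∈ (Q γ).support, η ∈ multipliers γ.1.1

/-- `z` is the fundamental syzygy `x_i f_t - ∑ Q_γ f_γ` of `F` that comes from the writing
`x_i F_t = ∑ Q_γ F_γ`, with `Q_γ` in the multiplicative variables of `γ`; here `p = (t, x_i)`. -/
def IsFundamentalSyzygy {P : Finset (Term n (Fin m))} (F : P → Vec n (Fin m) A) (p : NonMult P)
    (z : Vec n P A) : Prop :=
  ∃ Q : Vec n P A, IsMultFamily Q ∧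
    (MvPolynomial.X p.1.2 : PolyRing n A) • F p.1.1 = ∑ γ, Q γ • F γ ∧
    z = termVec A (Finsupp.single p.1.2 1, p.1.1) - Q

end marked

/-! ### The parameters `C` and `B` -/

section parameters

variable {n m : ℕ} {K : Type u} [Field K]

lemma finite_setOf_tdeg {n : ℕ} {ι : Type} [Finite ι] (d : ι → ℤ) (s : ℤ) :
    {t : Term n ι | tdeg d t = s}.Finite := by
  refine Set.Finite.subset (s := ⋃ k : ι, (fun α : Mon n => ((α, k) : Term n ι)) ''
    {α | α.degree ≤ (s - d k).toNat}) ?_ ?_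
  · exact Set.finite_iUnion fun k => (Finsupp.finite_of_degree_le _).image _
  · rintro ⟨α, k⟩ h
    refine Set.mem_iUnion.2 ⟨k, α, ?_, rfl⟩
    simp only [tdeg, Set.mem_ofPred_eq] at h ⊢
    omega

/-- The terms of `N(U)` that have the degree of the term `t ∈ P`. -/
abbrev TailTerm (d : Fin m → ℤ) (U : Submodule (PolyRing n K) (Vec n (Fin m) K))
    {P : Finset (Term n (Fin m))} (t : P) : Type :=
  {s : Term n (Fin m) // s ∈ sousEscalier U ∧ tdeg d s = tdeg d t.1}

/-- The set of parameters `C`. -/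
abbrev CParam (d : Fin m → ℤ) (U : Submodule (PolyRing n K) (Vec n (Fin m) K))
    (P : Finset (Term n (Fin m))) : Type :=
  Σ t : P, TailTerm d U t

/-- The degrees of the elements of `P`, that is, of the basis elements `f_γ`. -/
def degOne (d : Fin m → ℤ) (P : Finset (Term n (Fin m))) (γ : P) : ℤ := tdeg d γ.1

/-- The module `U⁽¹⁾`, generated by the terms `x_i f_γ` with `x_i` non-multiplicative for `γ`. -/
def UOne (K : Type u) [Field K] (P : Finset (Term n (Fin m))) :
    Submodule (PolyRing n K) (Vec n P K) :=
  Submodule.span (PolyRing n K)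
    (Set.range fun p : NonMult P => termVec K (Finsupp.single p.1.2 1, p.1.1))

/-- The set `s_{i,α,k}` of the terms `x ^ η f_γ` that may occur in the fundamental syzygy with
head term `x_i f_{α,k}`, for `p = (x ^ α e_k, x_i)`: `x ^ η` is a product of multiplicative
variables of `γ` smaller than `x_i`, the term `x ^ η f_γ` has the degree of `x_i f_{α,k}`, and it
is in `N(U⁽¹⁾)`. -/
abbrev SyzTerm (K : Type u) [Field K] (d : Fin m → ℤ) {P : Finset (Term n (Fin m))}
    (p : NonMult P) : Type :=
  {q : Term n P // q.1 ∈ slicedMultipliers p.1.2 q.2.1.1 ∧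
    tdeg (degOne d P) q = degOne d P p.1.1 + 1 ∧ q ∈ sousEscalier (UOne K P)}

/-- The set of parameters `B`. -/
abbrev BParam (K : Type u) [Field K] (d : Fin m → ℤ) (P : Finset (Term n (Fin m))) : Type :=
  Σ p : NonMult P, SyzTerm K d p

instance (d : Fin m → ℤ) (U : Submodule (PolyRing n K) (Vec n (Fin m) K))
    {P : Finset (Term n (Fin m))} (t : P) : Fintype (TailTerm d U t) :=
  haveI : Finite (TailTerm d U t) :=
    ((finite_setOf_tdeg d (tdeg d t.1)).subset fun _ h => h.2).to_subtype
  Fintype.ofFinite _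

instance (d : Fin m → ℤ) {P : Finset (Term n (Fin m))} (p : NonMult P) :
    Fintype (SyzTerm K d p) :=
  haveI : Finite (SyzTerm K d p) :=
    ((finite_setOf_tdeg (degOne d P) (degOne d P p.1.1 + 1)).subset fun _ h => h.2.1).to_subtype
  Fintype.ofFinite _

instance (P : Finset (Term n (Fin m))) : Fintype (NonMult P) := Fintype.ofFinite _

variable {A : Type u} [CommRing A]

/-- The marked set with the values `c` of the parameters `C`:
`F_t = t - ∑ c_{t,s} s`, where `s` runs through the terms in `N(U)` of the degree of `t`. -/
def markedSet (d : Fin m → ℤ) (U : Submodule (PolyRing n K) (Vec n (Fin m) K))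
    (P : Finset (Term n (Fin m))) (c : CParam d U P → A) (t : P) : Vec n (Fin m) A :=
  termVec A t.1 - ∑ s : TailTerm d U t, c ⟨t, s⟩ • termVec A s.1

/-- The fundamental pre-syzygies with the values `b` of the parameters `B`:
`x_i f_t - ∑ b_{p,q} q`, where `p = (t, x_i)` and `q` runs through `s_p`. -/
def preSyz (K : Type u) [Field K] (d : Fin m → ℤ) (P : Finset (Term n (Fin m)))
    (b : BParam K d P → A) (p : NonMult P) : Vec n P A :=
  termVec A (Finsupp.single p.1.2 1, p.1.1) - ∑ q : SyzTerm K d p, b ⟨p, q⟩ • termVec A q.1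

/-- The matrix `M₀`, whose columns are the elements of the marked set. -/
def matrixZero (d : Fin m → ℤ) (U : Submodule (PolyRing n K) (Vec n (Fin m) K))
    (P : Finset (Term n (Fin m))) (c : CParam d U P → A) : Matrix (Fin m) P (PolyRing n A) :=
  Matrix.of fun k t => markedSet d U P c t k

/-- The matrix `M₁`, whose columns are the fundamental pre-syzygies. -/
def matrixOne (K : Type u) [Field K] (d : Fin m → ℤ) (P : Finset (Term n (Fin m)))
    (b : BParam K d P → A) : Matrix P (NonMult P) (PolyRing n A) :=
  Matrix.of fun γ p => preSyz K d P b p γ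

end parameters

/-! ### The ideals `𝒰` and `𝒮` and their schemes -/

section ideals

variable {n m : ℕ} {K : Type u} [Field K]

/-- The ring `K[C]`. -/
abbrev RingC (d : Fin m → ℤ) (U : Submodule (PolyRing n K) (Vec n (Fin m) K))
    (P : Finset (Term n (Fin m))) : Type u :=
  MvPolynomial (CParam d U P) K

/-- The ring `K[B, C]`. -/
abbrev RingBC (d : Fin m → ℤ) (U : Submodule (PolyRing n K) (Vec n (Fin m) K))
    (P : Finset (Term n (Fin m))) : Type u :=
  MvPolynomial (BParam K d P ⊕ CParam d U P) K

/-- The inclusion of `K[C]` in `K[B, C]`. -/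
def inclC (d : Fin m → ℤ) (U : Submodule (PolyRing n K) (Vec n (Fin m) K))
    (P : Finset (Term n (Fin m))) : RingC d U P →ₐ[K] RingBC d U P :=
  MvPolynomial.rename Sum.inr

/-- The generic marked set `𝓕`, over `K[C]`. -/
def genericSet (d : Fin m → ℤ) (U : Submodule (PolyRing n K) (Vec n (Fin m) K))
    (P : Finset (Term n (Fin m))) : P → Vec n (Fin m) (RingC d U P) :=
  markedSet d U P (fun c => MvPolynomial.X c)

/-- The generic marked set `𝓕`, over `K[B, C]`. -/
def genericSetBC (d : Fin m → ℤ) (U : Submodule (PolyRing n K) (Vec n (Fin m) K))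
    (P : Finset (Term n (Fin m))) : P → Vec n (Fin m) (RingBC d U P) :=
  markedSet d U P (fun c => MvPolynomial.X (Sum.inr c))

/-- The generic fundamental pre-syzygies, over `K[B, C]`. -/
def genericPreSyz (d : Fin m → ℤ) (U : Submodule (PolyRing n K) (Vec n (Fin m) K))
    (P : Finset (Term n (Fin m))) : NonMult P → Vec n P (RingBC d U P) :=
  preSyz K d P (fun b => MvPolynomial.X (Sum.inl b))

/-- The ideal `𝒰 ⊆ K[C]`, generated by the coefficients of the `𝓕`-normal forms `g` of the
elements `x_i F_t`, for `F_t ∈ 𝓕` and `x_i` non-multiplicative for `t`. The normal form is the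
element `g` of `⟨N(U)⟩` in the unique writing `x_i F_t = ∑ Q_γ F_γ + g`, where `Q_γ` only has
multiplicative variables of `γ`. -/
def idealU (d : Fin m → ℤ) (U : Submodule (PolyRing n K) (Vec n (Fin m) K))
    (P : Finset (Term n (Fin m))) : Ideal (RingC d U P) :=
  Ideal.span {a | ∃ (p : NonMult P) (Q : Vec n P (RingC d U P))
    (g : Vec n (Fin m) (RingC d U P)) (t : Term n (Fin m)),
    IsMultFamily Q ∧ g ∈ termSpan (RingC d U P) (sousEscalier U) ∧
    (MvPolynomial.X p.1.2 : PolyRing n (RingC d U P)) • genericSet d U P p.1.1 =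
      ∑ γ, Q γ • genericSet d U P γ + g ∧
    a = coeffAt t g}

/-- The ideal `𝒮 ⊆ K[B, C]`, generated by the coefficients of the elements
`x_i F_t - ∑ B_{p,q} x ^ η F_γ` that are obtained by substituting the generic marked set
into the generic fundamental pre-syzygies. -/
def idealS (d : Fin m → ℤ) (U : Submodule (PolyRing n K) (Vec n (Fin m) K))
    (P : Finset (Term n (Fin m))) : Ideal (RingBC d U P) :=
  Ideal.span {a | ∃ (p : NonMult P) (t : Term n (Fin m)),
    a = coeffAt t (partialZero (genericSetBC d U P) (genericPreSyz d U P p))}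

/-- The spectrum of a `K`-algebra, as a scheme over `Spec K`. -/
abbrev specOver (K : Type u) [Field K] (A : Type u) [CommRing A] [Algebra K A] :
    Over (Spec (CommRingCat.of K)) :=
  (algSpec (CommRingCat.of K)).obj (op (CommAlgCat.of K A))

/-- The morphism of spectra over `Spec K` given by a homomorphism of `K`-algebras. -/
abbrev specOverMap {K : Type u} [Field K] {A A' : Type u} [CommRing A] [Algebra K A]
    [CommRing A'] [Algebra K A'] (φ : A →ₐ[K] A') : specOver K A' ⟶ specOver K A :=
  (algSpec (CommRingCat.of K)).map (CommAlgCat.ofHom φ).op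

/-- The scheme `Spec (K[C] / 𝒰)`. -/
def mfScheme (d : Fin m → ℤ) (U : Submodule (PolyRing n K) (Vec n (Fin m) K))
    (P : Finset (Term n (Fin m))) : Over (Spec (CommRingCat.of K)) :=
  specOver K (RingC d U P ⧸ idealU d U P)

/-- The scheme `Spec (K[B, C] / 𝒮)`. -/
def syzScheme (d : Fin m → ℤ) (U : Submodule (PolyRing n K) (Vec n (Fin m) K))
    (P : Finset (Term n (Fin m))) : Over (Spec (CommRingCat.of K)) :=
  specOver K (RingBC d U P ⧸ idealS d U P)

/-- The closed immersion of `Spec (K[C] / 𝒰)` in the affine space with coordinates `C`. -/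
def mfImmersion (d : Fin m → ℤ) (U : Submodule (PolyRing n K) (Vec n (Fin m) K))
    (P : Finset (Term n (Fin m))) : mfScheme d U P ⟶ specOver K (RingC d U P) :=
  specOverMap (Ideal.Quotient.mkₐ K (idealU d U P))

/-- The closed immersion of `Spec (K[B, C] / 𝒮)` in the affine space with coordinates `B, C`. -/
def syzImmersion (d : Fin m → ℤ) (U : Submodule (PolyRing n K) (Vec n (Fin m) K))
    (P : Finset (Term n (Fin m))) : syzScheme d U P ⟶ specOver K (RingBC d U P) :=
  specOverMap (Ideal.Quotient.mkₐ K (idealS d U P))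

/-- The projection of the affine space with coordinates `B, C` onto the coordinates `C`. -/
def projC (d : Fin m → ℤ) (U : Submodule (PolyRing n K) (Vec n (Fin m) K))
    (P : Finset (Term n (Fin m))) :
    specOver K (RingBC d U P) ⟶ specOver K (RingC d U P) :=
  specOverMap (inclC d U P)

end ideals

/-! ### Functors on Noetherian `K`-algebras -/

section functors

/-- The category of Noetherian `K`-algebras. -/
abbrev NoethAlg (K : Type u) [Field K] : Type (u + 1) :=
  ObjectProperty.FullSubcategory fun A : CommAlgCat.{u} K => IsNoetherianRing A

/-- The functor of points `A ↦ Hom_K(Spec A, X)` of a `K`-scheme `X`. -/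
def points {K : Type u} [Field K] (X : Over (Spec (CommRingCat.of K))) : NoethAlg K ⥤ Type u :=
  (ObjectProperty.ι _ ⋙ (algSpec (CommRingCat.of K)).rightOp) ⋙ yoneda.obj X

/-- The map on points given by a morphism of `K`-schemes. -/
def pointsMap {K : Type u} [Field K] {X Y : Over (Spec (CommRingCat.of K))} (g : X ⟶ Y) :
    points X ⟶ points Y :=
  Functor.whiskerLeft _ (yoneda.map g)

/-- The `A`-point of `Spec Q` given by a homomorphism `φ : Q → A`. -/
def algPoint {K : Type u} [Field K] {Q : Type u} [CommRing Q] [Algebra K Q] (A : NoethAlg K)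
    (φ : Q →ₐ[K] A.obj) : (points (specOver K Q)).obj A :=
  specOverMap φ

/-- `σ` applied to the coefficients of an element of `R_A ^ ι`. -/
def mapVec {n : ℕ} {ι : Type} {A A' : Type u} [CommRing A] [CommRing A'] (σ : A →+* A')
    (f : Vec n ι A) : Vec n ι A' :=
  fun k => MvPolynomial.map σ (f k)

/-- `σ(M)`: the submodule of `R_{A'} ^ ι` generated by the image of `M`. -/
def extendScalars {n : ℕ} {ι : Type} {A A' : Type u} [CommRing A] [CommRing A'] (σ : A →+* A')
    (M : Submodule (PolyRing n A) (Vec n ι A)) : Submodule (PolyRing n A') (Vec n ι A') :=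
  Submodule.span (PolyRing n A') (mapVec σ '' M)

lemma extendScalars_id {n : ℕ} {ι : Type} {A : Type u} [CommRing A]
    (M : Submodule (PolyRing n A) (Vec n ι A)) : extendScalars (RingHom.id A) M = M := by
  have : (mapVec (RingHom.id A) : Vec n ι A → Vec n ι A) = id := by
    funext f k; exact MvPolynomial.map_id _
  simp [extendScalars, this]

lemma extendScalars_comp {n : ℕ} {ι : Type} {A A' A'' : Type u} [CommRing A] [CommRing A']
    [CommRing A''] (σ : A →+* A') (τ : A' →+* A'') (M : Submodule (PolyRing n A) (Vec n ι A)) :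
    extendScalars (τ.comp σ) M = extendScalars τ (extendScalars σ M) := by
  refine le_antisymm (Submodule.span_le.2 ?_) (Submodule.span_le.2 ?_)
  · rintro _ ⟨f, hf, rfl⟩
    refine Submodule.subset_span ⟨mapVec σ f, Submodule.subset_span ⟨f, hf, rfl⟩, ?_⟩
    funext k
    simp [mapVec, MvPolynomial.map_map]
  · rintro _ ⟨f, hf, rfl⟩
    refine Submodule.span_induction (p := fun f _ => mapVec τ f ∈ extendScalars (τ.comp σ) M)
      ?_ ?_ ?_ ?_ hf
    · rintro _ ⟨g, hg, rfl⟩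
      refine Submodule.subset_span ⟨g, hg, ?_⟩
      funext k
      simp [mapVec, MvPolynomial.map_map]
    · have : mapVec τ (0 : Vec n ι A') = 0 := by funext k; simp [mapVec]
      rw [this]; exact zero_mem _
    · intro x y _ _ hx hy
      have : mapVec τ (x + y) = mapVec τ x + mapVec τ y := by funext k; simp [mapVec]
      rw [this]; exact add_mem hx hy
    · intro a x _ hx
      have : mapVec τ (a • x) = MvPolynomial.map τ a • mapVec τ x := by funext k; simp [mapVec]
      rw [this]; exact Submodule.smul_mem _ _ hx

/-- The functor that sends `A` to the set of all submodules `M` of `R_A ^ ι`, with extension of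
scalars. -/
def submoduleFunctor (K : Type u) [Field K] (n : ℕ) (ι : Type) : NoethAlg K ⥤ Type u where
  obj A := Submodule (PolyRing n A.obj) (Vec n ι A.obj)
  map σ := ↾fun M => extendScalars σ.hom.hom.toRingHom M
  map_id _ := ConcreteCategory.hom_ext _ _ fun M => extendScalars_id M
  map_comp σ τ := ConcreteCategory.hom_ext _ _ fun M =>
    extendScalars_comp σ.hom.hom.toRingHom τ.hom.hom.toRingHom M

/-- The functor that sends `A` to the set of all pairs `(M, S)` of submodules of `R_A ^ ι` and
`R_A ^ κ`, with extension of scalars in both components. -/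
def pairFunctor (K : Type u) [Field K] (n : ℕ) (ι κ : Type) : NoethAlg K ⥤ Type u where
  obj A := Submodule (PolyRing n A.obj) (Vec n ι A.obj) × Submodule (PolyRing n A.obj) (Vec n κ A.obj)
  map σ := ↾fun M => (extendScalars σ.hom.hom.toRingHom M.1, extendScalars σ.hom.hom.toRingHom M.2)
  map_id _ := by
    apply ConcreteCategory.hom_ext (C := Type u)
    intro M
    exact Prod.ext (extendScalars_id M.1) (extendScalars_id M.2)
  map_comp σ τ := by
    apply ConcreteCategory.hom_ext (C := Type u)
    intro M
    exact Prod.ext (extendScalars_comp σ.hom.hom.toRingHom τ.hom.hom.toRingHom M.1)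
      (extendScalars_comp σ.hom.hom.toRingHom τ.hom.hom.toRingHom M.2)

variable {n m : ℕ} {K : Type u} [Field K]

/-- The values of the `U`-marked functor: the graded submodules `M` of `R_A ^ m(-d)` with
`M ⊕ ⟨N(U)⟩ = R_A ^ m(-d)`. -/
def markedModules (d : Fin m → ℤ) (U : Submodule (PolyRing n K) (Vec n (Fin m) K)) (A : NoethAlg K) :
    Set ((submoduleFunctor K n (Fin m)).obj A) :=
  {M : Submodule (PolyRing n A.obj) (Vec n (Fin m) A.obj) | IsGraded d M ∧
    IsCompl (M.restrictScalars A.obj) (termSpan A.obj (sousEscalier U))}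

/-- The values of the `U`-marked syzygy functor: the pairs `(M, S)` in which `M` is a graded
submodule with `M ⊕ ⟨N(U)⟩ = R_A ^ m(-d)` and `S` is the module of syzygies of the `U`-marked
basis that generates `M`. -/
def markedSyzygies (d : Fin m → ℤ) (U : Submodule (PolyRing n K) (Vec n (Fin m) K))
    (P : Finset (Term n (Fin m))) (A : NoethAlg K) :
    Set ((pairFunctor K n (Fin m) P).obj A) :=
  {x : Submodule (PolyRing n A.obj) (Vec n (Fin m) A.obj) ×
      Submodule (PolyRing n A.obj) (Vec n P A.obj) |
    x.1 ∈ markedModules d U A ∧ ∃ F : P → Vec n (Fin m) A.obj,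
      IsMarkedBasis d U P F ∧ Submodule.span (PolyRing n A.obj) (Set.range F) = x.1 ∧ x.2 = syz F}

end functors

end

end MarkedSyz

open MarkedSyz

namespace MarkedSyz

noncomputable section

/-! ### Coefficients and spans of terms -/

section coefficients

variable {n : ℕ} {ι : Type} {A : Type u} [CommRing A]

/-! Everything rests on comparing cofactors in the colexicographic order, in which the largest
variable where two power products differ decides. If `x^η x^β = x^η' x^γ` with `x^η'` multiplicative
for `x^γ`, then either `η'` is smaller than `η`, or `x^β` itself lies in the cone of `x^γ`
(`colex_lt_or_mem_cone`). The tails of a marked set lie outside `U`, so rewriting a multiple of a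
tail term strictly lowers the cofactor. Hence reduction terminates (`normalSpan_eq_top`), and the
head belonging to a largest cofactor cannot cancel, so the writing `∑ Q_γ F_γ + g` is unique
(`eq_zero_of_partialZero_mem`). For `x_i F_t` with `x_i` non-multiplicative, all cofactors are
smaller than `x_i`, that is, products of smaller variables; this is why the sliced cones contain all
the terms a fundamental syzygy needs (`X_smul_mem_normalSpan`, `setOf_syzTerm_eq`).

The same order lets the pre-syzygies rewrite every vector of cofactors into a multiplicative family
(`span_preSyz_sup`). Once the pre-syzygies are syzygies (`IsSyzSolution`), uniqueness of normal
forms therefore shows both that the marked set generates a complement of `⟨N(U)⟩` and that the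
pre-syzygies generate all syzygies. Conversely, for a marked basis the normal form of `x_i F_t` lies
in `(F) ∩ ⟨N(U)⟩ = 0`. So the elements of both functors correspond to the solutions `(c, b)`, where
`M` determines `c` and `c` determines `b`.

Over `K[C]` there are generic values of `B` for which each pre-syzygy is sent to the normal form of
`x_i F_t`. The coefficients of these normal forms generate `𝒰`, and substituting the generic values
for `B` inverts `K[C]/𝒰 → K[B,C]/𝒮` (`exists_quotient_algEquiv`). The elimination statement, the
isomorphism of schemes and the representability of the marked functor follow from this. -/

@[simp] lemma coeffAt_zero (t : Term n ι) : coeffAt t (0 : Vec n ι A) = 0 := by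
  simp [coeffAt]

@[simp] lemma coeffAt_add (t : Term n ι) (f g : Vec n ι A) :
    coeffAt t (f + g) = coeffAt t f + coeffAt t g := by
  simp [coeffAt]

@[simp] lemma coeffAt_sub (t : Term n ι) (f g : Vec n ι A) :
    coeffAt t (f - g) = coeffAt t f - coeffAt t g := by
  simp [coeffAt]

@[simp] lemma coeffAt_smul (t : Term n ι) (a : A) (f : Vec n ι A) :
    coeffAt t (a • f) = a * coeffAt t f := by
  simp [coeffAt]

lemma coeffAt_sum {κ : Type*} (t : Term n ι) (s : Finset κ) (f : κ → Vec n ι A) :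
    coeffAt t (∑ k ∈ s, f k) = ∑ k ∈ s, coeffAt t (f k) := by
  simp [coeffAt, MvPolynomial.coeff_sum]

lemma vec_ext {f g : Vec n ι A} (h : ∀ t, coeffAt t f = coeffAt t g) : f = g := by
  funext k
  ext β
  exact h (β, k)

variable [DecidableEq ι]

lemma coeffAt_termVec [DecidableEq (Term n ι)] (t s : Term n ι) :
    coeffAt t (termVec A s) = if s = t then 1 else 0 := by
  obtain ⟨α, k⟩ := t
  obtain ⟨β, l⟩ := s
  by_cases h : k = l
  · subst h
    simp [coeffAt, termVec, MvPolynomial.coeff_monomial]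
  · have h' : l ≠ k := fun h' => h h'.symm
    simp [coeffAt, termVec, h, h']

@[simp] lemma coeffAt_termVec_self (t : Term n ι) : coeffAt t (termVec A t) = 1 := by
  classical simp [coeffAt_termVec]

lemma coeffAt_termVec_of_ne {t s : Term n ι} (h : s ≠ t) : coeffAt t (termVec A s) = 0 := by
  classical simp [coeffAt_termVec, h]

lemma monomial_smul_termVec (η : Mon n) (a : A) (t : Term n ι) :
    (MvPolynomial.monomial η a : PolyRing n A) • termVec A t = a • termVec A (η + t.1, t.2) := by
  funext k
  by_cases h : k = t.2
  · subst h
    simp [termVec, MvPolynomial.monomial_mul, MvPolynomial.smul_monomial]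
  · simp [termVec, h]

lemma exists_finset_sum_termVec [Finite ι] (f : Vec n ι A) :
    ∃ S : Finset (Term n ι), (∀ t, t ∈ S ↔ coeffAt t f ≠ 0) ∧
      f = ∑ t ∈ S, coeffAt t f • termVec A t := by
  classical
  have hfin : {t : Term n ι | coeffAt t f ≠ 0}.Finite := by
    refine Set.Finite.subset (s := ⋃ k : ι, (fun α : Mon n => ((α, k) : Term n ι)) ''
      ((f k).support : Set (Mon n))) ?_ ?_
    · exact Set.finite_iUnion fun k => (Finset.finite_toSet _).image _
    · rintro ⟨α, k⟩ h
      exact Set.mem_iUnion.2 ⟨k, α, by simpa [coeffAt] using h, rfl⟩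
  refine ⟨hfin.toFinset, fun t => by simp, vec_ext fun t => ?_⟩
  rw [coeffAt_sum]
  by_cases h : coeffAt t f = 0
  · rw [h, eq_comm]
    refine Finset.sum_eq_zero fun s hs => ?_
    have hst : s ≠ t := by
      rintro rfl
      simp [h] at hs
    simp [coeffAt_termVec_of_ne hst]
  · rw [Finset.sum_eq_single t]
    · simp
    · intro s _ hst
      simp [coeffAt_termVec_of_ne hst]
    · intro ht
      simp [h] at ht

lemma termVec_mem_termSpan {T : Set (Term n ι)} {t : Term n ι} (h : t ∈ T) :
    termVec A t ∈ termSpan A T :=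
  Submodule.subset_span ⟨t, h, rfl⟩

lemma termSpan_mono {T T' : Set (Term n ι)} (h : T ⊆ T') : termSpan A T ≤ termSpan A T' :=
  Submodule.span_mono (Set.image_mono h)

/-- Spans of terms become conditions on supports, which is the form in which degrees, cones and
`N(U)` are handled below. -/
lemma mem_termSpan [Finite ι] {T : Set (Term n ι)} {f : Vec n ι A} :
    f ∈ termSpan A T ↔ ∀ t, coeffAt t f ≠ 0 → t ∈ T := by
  constructor
  · intro h
    induction h using Submodule.span_induction with
    | mem x hx =>
      obtain ⟨s, hs, rfl⟩ := hx
      intro t ht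
      by_contra hn
      refine ht (coeffAt_termVec_of_ne ?_)
      rintro rfl
      exact hn hs
    | zero => simp
    | add x y _ _ hx hy =>
      intro t ht
      by_cases h : coeffAt t x = 0
      · exact hy t (by simpa [h] using ht)
      · exact hx t h
    | smul a x _ hx =>
      exact fun t ht => hx t fun h => ht (by simp [h])
  · intro h
    obtain ⟨S, hS, hf⟩ := exists_finset_sum_termVec f
    rw [hf]
    exact Submodule.sum_mem _ fun t ht =>
      Submodule.smul_mem _ _ (termVec_mem_termSpan (h t ((hS t).1 ht)))

/-- Used to read parameter values off an element: with `p` the condition defining `TailTerm` or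
`SyzTerm`, the coefficients on the right are the values of `C` or `B`. -/
lemma eq_sum_subtype [Finite ι] {p : Term n ι → Prop} [Fintype {t // p t}] {f : Vec n ι A}
    (h : f ∈ termSpan A {t | p t}) :
    f = ∑ t : {t // p t}, coeffAt t.1 f • termVec A t.1 := by
  classical
  rw [mem_termSpan] at h
  refine vec_ext fun t => ?_
  rw [coeffAt_sum]
  by_cases ht : p t
  · rw [Finset.sum_eq_single ⟨t, ht⟩]
    · simp
    · intro s _ hs
      have : s.1 ≠ t := fun h' => hs (Subtype.ext h')
      simp [coeffAt_termVec_of_ne this]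
    · simp
  · have h0 : coeffAt t f = 0 := by
      by_contra h'
      exact ht (h t h')
    rw [h0, Finset.sum_eq_zero]
    intro s _
    have : s.1 ≠ t := by
      rintro rfl
      exact ht s.2
    simp [coeffAt_termVec_of_ne this]

lemma coeffAt_sum_subtype {p : Term n ι → Prop} [Fintype {t // p t}] (b : {t // p t} → A)
    (q : {t // p t}) : coeffAt q.1 (∑ t, b t • termVec A t.1) = b q := by
  classical
  rw [coeffAt_sum, Finset.sum_eq_single q]
  · simp
  · intro s _ hs
    have : s.1 ≠ q.1 := fun h' => hs (Subtype.ext h')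
    simp [coeffAt_termVec_of_ne this]
  · simp

lemma sum_subtype_mem_termSpan {p : Term n ι → Prop} [Fintype {t // p t}] (b : {t // p t} → A) :
    ∑ t, b t • termVec A t.1 ∈ termSpan A {t | p t} :=
  Submodule.sum_mem _ fun t _ => Submodule.smul_mem _ _ (termVec_mem_termSpan t.2)

lemma termSpan_univ [Finite ι] : termSpan A (Set.univ : Set (Term n ι)) = ⊤ :=
  eq_top_iff.2 fun _ _ => mem_termSpan.2 fun _ _ => trivial

lemma degPiece_eq_termSpan [Finite ι] (d : ι → ℤ) (s : ℤ) :
    degPiece A d s = termSpan A {t : Term n ι | tdeg d t = s} := by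
  ext f
  rw [mem_termSpan]
  rfl

omit [DecidableEq ι] in
lemma tdeg_add (d : ι → ℤ) (η : Mon n) (t : Term n ι) :
    tdeg d (η + t.1, t.2) = (η.degree : ℤ) + tdeg d t := by
  simp [tdeg, add_assoc]

end coefficients

/-! ### Power products in the colexicographic order -/

section colex

variable {n : ℕ}

lemma colex_lt_iff {η η' : Mon n} :
    toColex (⇑η) < toColex (⇑η') ↔ ∃ j, (∀ l, j < l → η l = η' l) ∧ η j < η' j :=
  Iff.rfl

lemma colex_add_lt_add {η η' : Mon n} (h : toColex (⇑η) < toColex (⇑η')) (δ : Mon n) :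
    toColex (⇑(δ + η)) < toColex (⇑(δ + η')) := by
  rw [colex_lt_iff] at h ⊢
  obtain ⟨j, hj, hlt⟩ := h
  exact ⟨j, fun l hl => by simp [hj l hl], by simpa using hlt⟩

/-- The order is well-founded because there are finitely many variables with exponents in `ℕ`. No
bound on the degree is needed, although below a given power product there may be infinitely many
others. -/
lemma colex_induction {p : Mon n → Prop}
    (h : ∀ η : Mon n, (∀ η' : Mon n, toColex (⇑η') < toColex (⇑η) → p η') → p η) (η : Mon n) : p η :=
  (InvImage.wf (fun η : Mon n => toColex (η : Fin (n + 1) → ℕ)) wellFounded_lt).induction η h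

/-- Together with `colex_lt_single`: the power products below `x_i` are exactly those in the
variables smaller than `x_i`, in any degree. This translates between sliced cones and the order. -/
lemma eq_zero_of_colex_lt_single {η : Mon n} {i : Fin (n + 1)}
    (h : toColex (⇑η) < toColex (⇑(Finsupp.single i 1 : Mon n))) {j : Fin (n + 1)}
    (hj : η j ≠ 0) : j < i := by
  obtain ⟨k, hk, hlt⟩ := colex_lt_iff.1 h
  have hki : i = k := by
    by_contra hne
    rw [Finsupp.single_eq_of_ne' hne] at hlt
    omega
  subst hki
  rw [Finsupp.single_eq_same] at hlt
  by_contra hji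
  rcases (not_lt.1 hji).eq_or_lt with rfl | hlt'
  · omega
  · exact hj (by rw [hk j hlt', Finsupp.single_eq_of_ne hlt'.ne'])

lemma colex_lt_single {η : Mon n} {i : Fin (n + 1)} (h : ∀ j, η j ≠ 0 → j < i) :
    toColex (⇑η) < toColex (⇑(Finsupp.single i 1 : Mon n)) := by
  have h0 : ∀ l, i ≤ l → η l = 0 := fun l hl => by
    by_contra h'
    exact absurd (h l h') (not_lt.2 hl)
  exact colex_lt_iff.2 ⟨i, fun l hl => by
    rw [h0 l hl.le, Finsupp.single_eq_of_ne hl.ne'], by simp [h0 i le_rfl]⟩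

lemma multipliers_of_le {α δ δ' : Mon n} (h : δ ∈ multipliers α) (hle : δ' ≤ δ) :
    δ' ∈ multipliers α := fun j hj => h j fun h0 => hj (Nat.le_zero.1 (h0 ▸ hle j))

/-- Rewriting a multiple of a term `β` to an element of the cone of `γ` decreases the cofactor,
unless `β` itself is in the cone of `γ`. -/
lemma colex_lt_or_mem_cone {η η' β γ : Mon n} (h : η + β = η' + γ) (hη' : η' ∈ multipliers γ) :
    toColex (⇑η') < toColex (⇑η) ∨ η ≤ η' ∧ β = (η' - η) + γ := by
  by_cases hlt : toColex (⇑η') < toColex (⇑η)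
  · exact Or.inl hlt
  right
  have hle : η ≤ η' := by
    rcases (not_lt.1 hlt).eq_or_lt with heq | hlt'
    · have : η = η' := DFunLike.coe_injective (toColex.injective heq)
      exact this.le
    · obtain ⟨j, hj, hj'⟩ := colex_lt_iff.1 hlt'
      intro l
      rcases lt_trichotomy l j with hl | rfl | hl
      -- At the largest difference `j` the exponent of `η'` is positive, so `x_j` is multiplicative
      -- for `γ`. Hence `γ` has no variable below `x_j`, and there `η'` equals `η + β`.
      · have hγ : γ l = 0 := by
          by_contra h0
          exact absurd (hη' j (by omega) l h0) (not_le.2 hl)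
        have := DFunLike.congr_fun h l
        simp only [Finsupp.add_apply] at this
        omega
      · exact hj'.le
      · exact (hj l hl).le
  refine ⟨hle, ?_⟩
  ext l
  have h1 := DFunLike.congr_fun h l
  have h2 := hle l
  simp only [Finsupp.add_apply, Finsupp.tsub_apply] at h1 ⊢
  omega

end colex

/-! ### Normal forms with respect to a marked set -/

section normalForms

variable {n m : ℕ} {K : Type u} [Field K] {A : Type u} [CommRing A]
  {d : Fin m → ℤ} {U : Submodule (PolyRing n K) (Vec n (Fin m) K)} {P : Finset (Term n (Fin m))}

/-- The terms `x ^ η f_γ` in which `x ^ η` is a product of multiplicative variables of `γ`. -/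
def multTerms (P : Finset (Term n (Fin m))) : Set (Term n P) :=
  {q | q.1 ∈ multipliers q.2.1.1}

lemma isMultFamily_iff {Q : Vec n P A} :
    IsMultFamily Q ↔ Q ∈ termSpan A (multTerms P) := by
  rw [mem_termSpan]
  constructor
  · rintro h ⟨η, γ⟩ ht
    exact h γ η (MvPolynomial.mem_support_iff.2 ht)
  · intro h γ η hη
    exact h (η, γ) (MvPolynomial.mem_support_iff.1 hη)

lemma not_mem_sousEscalier_iff (hP : IsPommaretBasis U P) {t : Term n (Fin m)} :
    t ∉ sousEscalier U ↔ ∃ γ : P, ∃ η ∈ multipliers γ.1.1, t = (η + γ.1.1, γ.1.2) := by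
  have h : t ∉ sousEscalier U ↔ t ∈ {t : Term n (Fin m) | termVec K t ∈ U} := not_not
  rw [h, hP.iUnion_cone]
  simp [pommaretCone]

lemma mem_not_mem_sousEscalier (hP : IsPommaretBasis U P) (γ : P) : γ.1 ∉ sousEscalier U :=
  (not_mem_sousEscalier_iff hP).2 ⟨γ, 0, fun j hj => absurd rfl hj, by simp⟩

lemma cone_unique (hP : IsPommaretBasis U P) {γ γ' : P} {η η' : Mon n}
    (hη : η ∈ multipliers γ.1.1) (hη' : η' ∈ multipliers γ'.1.1)
    (h : η + γ.1.1 = η' + γ'.1.1) (h2 : γ.1.2 = γ'.1.2) : γ = γ' ∧ η = η' := by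
  have : γ = γ' := by
    by_contra hne
    exact Set.disjoint_left.1 (hP.disjoint_cone γ.2 γ'.2 fun h' => hne (Subtype.ext h'))
      (show (η + γ.1.1, γ.1.2) ∈ _ from ⟨η, hη, rfl⟩) ⟨η', hη', by rw [h, h2]⟩
  subst this
  exact ⟨rfl, add_right_cancel h⟩

lemma tdeg_degOne (d : Fin m → ℤ) (q : Term n P) :
    tdeg (degOne d P) q = tdeg d (q.1 + q.2.1.1, q.2.1.2) := by
  rw [tdeg_add]; rfl

lemma partialZero_apply (F : P → Vec n (Fin m) A) (v : Vec n P A) :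
    partialZero F v = ∑ γ, v γ • F γ := rfl

lemma partialZero_termVec (F : P → Vec n (Fin m) A) (q : Term n P) :
    partialZero F (termVec A q) = (MvPolynomial.monomial q.1 1 : PolyRing n A) • F q.2 := by
  rw [partialZero_apply, Finset.sum_eq_single q.2]
  · simp [termVec]
  · intro γ _ hγ
    simp [termVec, hγ]
  · simp

lemma monomial_smul_markedSet (c : CParam d U P → A) (η : Mon n) (t : P) :
    (MvPolynomial.monomial η 1 : PolyRing n A) • markedSet d U P c t =
      termVec A (η + t.1.1, t.1.2) -
        ∑ s : TailTerm d U t, c ⟨t, s⟩ • termVec A (η + s.1.1, s.1.2) := by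
  rw [markedSet, smul_sub, monomial_smul_termVec, one_smul, Finset.smul_sum]
  congr 1
  refine Finset.sum_congr rfl fun s _ => ?_
  rw [smul_comm, monomial_smul_termVec, one_smul]

/-- The elements `∑ Q_γ F_γ + g` with `Q` in the span of `T` and `g` in the span of `N`. -/
def normalSpan (c : CParam d U P → A) (T : Set (Term n P)) (N : Set (Term n (Fin m))) :
    Submodule A (Vec n (Fin m) A) :=
  (termSpan A T).map ((partialZero (markedSet d U P c)).restrictScalars A) ⊔ termSpan A N

lemma mem_normalSpan {c : CParam d U P → A} {T : Set (Term n P)} {N : Set (Term n (Fin m))}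
    {h : Vec n (Fin m) A} : h ∈ normalSpan c T N ↔
      ∃ Q ∈ termSpan A T, ∃ g ∈ termSpan A N, h = partialZero (markedSet d U P c) Q + g := by
  simp only [normalSpan, Submodule.mem_sup, Submodule.mem_map]
  constructor
  · rintro ⟨_, ⟨Q, hQ, rfl⟩, g, hg, rfl⟩
    exact ⟨Q, hQ, g, hg, rfl⟩
  · rintro ⟨Q, hQ, g, hg, rfl⟩
    exact ⟨_, ⟨Q, hQ, rfl⟩, g, hg, rfl⟩

lemma normalSpan_mono (c : CParam d U P → A) {T T' : Set (Term n P)}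
    {N N' : Set (Term n (Fin m))} (hT : T ⊆ T') (hN : N ⊆ N') :
    normalSpan c T N ≤ normalSpan c T' N' :=
  sup_le_sup (Submodule.map_mono (termSpan_mono hT)) (termSpan_mono hN)

/-- The terms `x ^ η' f_γ` of degree `s` with `x ^ η'` a product of multiplicative variables of `γ`
and smaller than `x ^ η`. -/
def multTermsBelow (d : Fin m → ℤ) (P : Finset (Term n (Fin m))) (η : Mon n) (s : ℤ) :
    Set (Term n P) :=
  {q | q ∈ multTerms P ∧ toColex (⇑q.1) < toColex (⇑η) ∧ tdeg (degOne d P) q = s}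

/-- The terms of degree `s` in `N(U)`. -/
def sousEscalierDeg (d : Fin m → ℤ) (U : Submodule (PolyRing n K) (Vec n (Fin m) K)) (s : ℤ) :
    Set (Term n (Fin m)) :=
  {t | t ∈ sousEscalier U ∧ tdeg d t = s}

/-- One reduction step: the head of `x^η F_γ` equals `x^η F_γ` plus a combination of the multiplied
tail terms. -/
lemma termVec_mem_normalSpan_of_cone (c : CParam d U P → A) (γ : P) (η : Mon n)
    {T : Set (Term n P)} {N : Set (Term n (Fin m))} (hT : (η, γ) ∈ T)
    (h : ∀ s : TailTerm d U γ, termVec A (η + s.1.1, s.1.2) ∈ normalSpan c T N) :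
    termVec A (η + γ.1.1, γ.1.2) ∈ normalSpan c T N := by
  have h1 : (partialZero (markedSet d U P c)) (termVec A (η, γ)) ∈ normalSpan c T N :=
    mem_normalSpan.2 ⟨_, termVec_mem_termSpan hT, 0, zero_mem _, (add_zero _).symm⟩
  rw [partialZero_termVec, monomial_smul_markedSet] at h1
  have h2 : ∑ s : TailTerm d U γ, c ⟨γ, s⟩ • termVec A (η + s.1.1, s.1.2) ∈ normalSpan c T N :=
    Submodule.sum_mem _ fun s _ => Submodule.smul_mem _ _ (h s)
  simpa using add_mem h1 h2

/-- Induction on the cofactor. A multiple of `s` that falls into `U` lies in the cone of some `γ`,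
with a smaller cofactor since `s` is not in `U`. After one reduction step the tail terms of `γ`
carry that smaller cofactor, and homogeneity keeps the degree fixed. -/
lemma termVec_mem_normalSpan_below (hP : IsPommaretBasis U P) (c : CParam d U P → A) (η : Mon n) :
    ∀ s ∈ sousEscalier U, termVec A (η + s.1, s.2) ∈
      normalSpan c (multTermsBelow d P η ((η.degree : ℤ) + tdeg d s))
        (sousEscalierDeg d U ((η.degree : ℤ) + tdeg d s)) := by
  induction η using colex_induction with
  | h η ih =>
  intro s hs
  by_cases hηs : (η + s.1, s.2) ∈ sousEscalier U
  · exact mem_normalSpan.2 ⟨0, zero_mem _, _, termVec_mem_termSpan ⟨hηs, tdeg_add d η s⟩,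
      by simp⟩
  obtain ⟨γ, η', hη', heq⟩ := (not_mem_sousEscalier_iff hP).1 hηs
  have heq1 : η + s.1 = η' + γ.1.1 := (Prod.ext_iff.1 heq).1
  have heq2 : s.2 = γ.1.2 := (Prod.ext_iff.1 heq).2
  have hlt : toColex (⇑η') < toColex (⇑η) := by
    rcases colex_lt_or_mem_cone heq1 hη' with h | ⟨_, h⟩
    · exact h
    · refine absurd hs ((not_mem_sousEscalier_iff hP).2
        ⟨γ, η' - η, multipliers_of_le hη' tsub_le_self, Prod.ext h heq2⟩)
  have hdeg : (η'.degree : ℤ) + tdeg d γ.1 = (η.degree : ℤ) + tdeg d s := by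
    rw [← tdeg_add, ← tdeg_add, heq]
  rw [heq]
  refine termVec_mem_normalSpan_of_cone c γ η' ?_ fun s' => ?_
  · exact ⟨hη', hlt, by rw [tdeg_degOne, tdeg_add, hdeg]⟩
  · have := ih η' hlt s'.1 s'.2.1
    rw [s'.2.2, hdeg] at this
    refine normalSpan_mono c (fun q hq => ?_) subset_rfl this
    exact ⟨hq.1, hq.2.1.trans hlt, hq.2.2⟩

/-- Here the first reduction need not lower a cofactor, but it leaves only multiples of tail terms,
to which the preceding induction applies. -/
lemma termVec_mem_normalSpan (hP : IsPommaretBasis U P) (c : CParam d U P → A)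
    (t : Term n (Fin m)) :
    termVec A t ∈ normalSpan c {q | q ∈ multTerms P ∧ tdeg (degOne d P) q = tdeg d t}
      (sousEscalierDeg d U (tdeg d t)) := by
  by_cases ht : t ∈ sousEscalier U
  · exact mem_normalSpan.2 ⟨0, zero_mem _, _, termVec_mem_termSpan ⟨ht, rfl⟩, by simp⟩
  obtain ⟨γ, η, hη, rfl⟩ := (not_mem_sousEscalier_iff hP).1 ht
  refine termVec_mem_normalSpan_of_cone c γ η ?_ fun s => ?_
  · exact ⟨hη, tdeg_degOne d _⟩
  · have := termVec_mem_normalSpan_below hP c η s.1 s.2.1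
    rw [s.2.2, ← tdeg_add] at this
    refine normalSpan_mono c (fun q hq => ?_) subset_rfl this
    exact ⟨hq.1, hq.2.2⟩

/-- Every homogeneous element has a homogeneous normal form. -/
lemma mem_normalSpan_of_mem_degPiece (hP : IsPommaretBasis U P) (c : CParam d U P → A) {s : ℤ}
    {f : Vec n (Fin m) A} (hf : f ∈ degPiece A d s) :
    f ∈ normalSpan c {q | q ∈ multTerms P ∧ tdeg (degOne d P) q = s} (sousEscalierDeg d U s) := by
  rw [degPiece_eq_termSpan] at hf
  refine Submodule.span_le.2 ?_ hf
  rintro _ ⟨t, rfl, rfl⟩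
  exact termVec_mem_normalSpan hP c t

lemma normalSpan_eq_top (hP : IsPommaretBasis U P) (c : CParam d U P → A) :
    normalSpan c (multTerms P) (sousEscalier U) = ⊤ := by
  rw [eq_top_iff, ← termSpan_univ]
  refine Submodule.span_le.2 ?_
  rintro _ ⟨t, _, rfl⟩
  exact normalSpan_mono c (fun q hq => hq.1) (fun q hq => hq.1) (termVec_mem_normalSpan hP c t)

/-- The normal form of `x_i F_t`, for a non-multiplicative variable `x_i` of `t`. -/
lemma X_smul_mem_normalSpan (hP : IsPommaretBasis U P) (c : CParam d U P → A) (p : NonMult P) :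
    (MvPolynomial.X p.1.2 : PolyRing n A) • markedSet d U P c p.1.1 ∈
      normalSpan c (multTermsBelow d P (Finsupp.single p.1.2 1) (degOne d P p.1.1 + 1))
        (sousEscalierDeg d U (degOne d P p.1.1 + 1)) := by
  obtain ⟨⟨t, i⟩, hi⟩ := p
  dsimp only at hi ⊢
  have hdeg : ((Finsupp.single i 1 : Mon n).degree : ℤ) + tdeg d t.1 = degOne d P t + 1 := by
    rw [Finsupp.degree_single, add_comm]; rfl
  rw [MvPolynomial.X, monomial_smul_markedSet]
  have tail : ∀ s : TailTerm d U t, termVec A (Finsupp.single i 1 + s.1.1, s.1.2) ∈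
      normalSpan c (multTermsBelow d P (Finsupp.single i 1) (degOne d P t + 1))
        (sousEscalierDeg d U (degOne d P t + 1)) := fun s => by
    have := termVec_mem_normalSpan_below hP c (Finsupp.single i 1) s.1 s.2.1
    rwa [s.2.2, hdeg] at this
  refine sub_mem ?_ (Submodule.sum_mem _ fun s _ => Submodule.smul_mem _ _ (tail s))
  by_cases ht : (Finsupp.single i 1 + t.1.1, t.1.2) ∈ sousEscalier U
  · exact mem_normalSpan.2 ⟨0, zero_mem _, _, termVec_mem_termSpan ⟨ht, by rw [tdeg_add, hdeg]⟩,
      by simp⟩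
  obtain ⟨γ, η, hη, heq⟩ := (not_mem_sousEscalier_iff hP).1 ht
  have heq1 : Finsupp.single i 1 + t.1.1 = η + γ.1.1 := (Prod.ext_iff.1 heq).1
  have heq2 : t.1.2 = γ.1.2 := (Prod.ext_iff.1 heq).2
  have hlt : toColex (⇑η) < toColex (⇑(Finsupp.single i 1 : Mon n)) := by
    rcases colex_lt_or_mem_cone heq1 hη with h | ⟨hle, h⟩
    · exact h
    -- Otherwise `t` would lie in the cone of `γ`. Disjointness of the cones forces `γ = t`, and
    -- then `x_i`, which divides `x^η`, would be multiplicative for `t`.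
    · exfalso
      obtain ⟨rfl, -⟩ := cone_unique hP (γ := t) (η := 0) (fun j hj => absurd rfl hj)
        (multipliers_of_le hη tsub_le_self) (by rwa [zero_add]) heq2
      refine hi (hη i ?_)
      have := hle i
      rw [Finsupp.single_eq_same] at this
      omega
  have hdeg' : (η.degree : ℤ) + tdeg d γ.1 = degOne d P t + 1 := by
    rw [← hdeg, ← tdeg_add, ← tdeg_add, heq]
  rw [heq]
  refine termVec_mem_normalSpan_of_cone c γ η ?_ fun s => ?_
  · exact ⟨hη, hlt, by rw [tdeg_degOne, tdeg_add, hdeg']⟩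
  · have := termVec_mem_normalSpan_below hP c η s.1 s.2.1
    rw [s.2.2, hdeg'] at this
    refine normalSpan_mono c (fun q hq => ?_) subset_rfl this
    exact ⟨hq.1, hq.2.1.trans hlt, hq.2.2⟩

/-- Normal forms are unique. -/
lemma eq_zero_of_partialZero_mem (hP : IsPommaretBasis U P) (c : CParam d U P → A)
    {Q : Vec n P A} (hQ : Q ∈ termSpan A (multTerms P))
    (h : partialZero (markedSet d U P c) Q ∈ termSpan A (sousEscalier U)) : Q = 0 := by
  classical
  obtain ⟨S, hS, hQS⟩ := exists_finset_sum_termVec Q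
  rw [mem_termSpan] at hQ h
  rcases S.eq_empty_or_nonempty with rfl | hne
  · simpa using hQS
  exfalso
  -- Choose a largest cofactor in `Q`. Its head lies in `U`, and the claim is that nothing else
  -- contributes to the coefficient there, so the image could not lie in `⟨N(U)⟩`.
  obtain ⟨⟨η, γ⟩, hqS, hmax⟩ := S.exists_max_image (fun q => toColex (⇑q.1)) hne
  have hη : η ∈ multipliers γ.1.1 := hQ _ ((hS _).1 hqS)
  refine (not_mem_sousEscalier_iff hP).2 ⟨γ, η, hη, rfl⟩ (h (η + γ.1.1, γ.1.2) ?_)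
  suffices h' : coeffAt (η + γ.1.1, γ.1.2) (partialZero (markedSet d U P c) Q) =
      coeffAt (η, γ) Q by
    rw [h']
    exact (hS _).1 hqS
  have key : ∀ q ∈ S, coeffAt (η + γ.1.1, γ.1.2)
      (partialZero (markedSet d U P c) (termVec A q)) = if q = (η, γ) then 1 else 0 := by
    rintro ⟨η', γ'⟩ hq
    rw [partialZero_termVec, monomial_smul_markedSet, coeffAt_sub, coeffAt_sum, Finset.sum_eq_zero,
      sub_zero, coeffAt_termVec]
    · refine if_congr ⟨fun heq => ?_, fun heq => ?_⟩ rfl rfl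
      · obtain ⟨rfl, rfl⟩ := cone_unique hP (hQ _ ((hS _).1 hq)) hη ((Prod.ext_iff.1 heq).1)
          ((Prod.ext_iff.1 heq).2)
        rfl
      · cases heq
        rfl
    -- A tail term of another summand cannot hit this head: either the chosen cofactor would be
    -- smaller than that of the summand, against maximality, or the tail term would be in `U`.
    · intro s _
      rw [coeffAt_smul, coeffAt_termVec_of_ne, mul_zero]
      intro heq
      have heq1 : η' + s.1.1 = η + γ.1.1 := (Prod.ext_iff.1 heq).1
      have heq2 : s.1.2 = γ.1.2 := (Prod.ext_iff.1 heq).2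
      rcases colex_lt_or_mem_cone heq1 hη with hlt | ⟨_, hs⟩
      · exact absurd hlt (not_lt.2 (hmax _ hq))
      · exact (not_mem_sousEscalier_iff hP).2 ⟨γ, η - η', multipliers_of_le hη tsub_le_self,
          Prod.ext hs heq2⟩ s.2.1
  conv_lhs => rw [hQS]
  rw [map_sum, coeffAt_sum]
  rw [Finset.sum_eq_single (η, γ)]
  · rw [LinearMap.map_smul_of_tower, coeffAt_smul, key _ hqS]
    simp
  · intro q hq hne'
    rw [LinearMap.map_smul_of_tower, coeffAt_smul, key _ hq, if_neg hne', mul_zero]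
  · exact fun h' => absurd hqS h'

end normalForms

/-! ### Reduction modulo the fundamental pre-syzygies -/

section preSyzygies

variable {n m : ℕ} {K : Type u} [Field K] {A : Type u} [CommRing A]
  {d : Fin m → ℤ} {U : Submodule (PolyRing n K) (Vec n (Fin m) K)} {P : Finset (Term n (Fin m))}

/-- The component of `U⁽¹⁾` at `γ` is contained in the monomial ideal generated by the
non-multiplicative variables of `γ`, none of which divides a product of multiplicative ones. So the
condition `q ∈ N(U⁽¹⁾)` in `SyzTerm` holds automatically. -/
lemma mem_sousEscalier_UOne {q : Term n P} (hq : q ∈ multTerms P) :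
    q ∈ sousEscalier (UOne K P) := by
  obtain ⟨η, γ⟩ := q
  intro hmem
  have hle : UOne K P ≤ Submodule.comap
      (LinearMap.proj γ : Vec n P K →ₗ[PolyRing n K] PolyRing n K)
      (Ideal.span ((fun s => MvPolynomial.monomial s (1 : K)) ''
        {s : Mon n | ∃ i, ¬ IsMult γ.1.1 i ∧ s = Finsupp.single i 1})) := by
    refine Submodule.span_le.2 ?_
    rintro _ ⟨⟨⟨t, i⟩, hi⟩, rfl⟩
    by_cases h : t = γ
    · subst h
      refine Ideal.subset_span ⟨Finsupp.single i 1, ⟨i, hi, rfl⟩, ?_⟩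
      simp [termVec]
    · have h' : γ ≠ t := fun h' => h h'.symm
      simp [termVec, h']
  have h := hle hmem
  rw [Submodule.mem_comap, MvPolynomial.mem_ideal_span_monomial_image] at h
  obtain ⟨_, ⟨i, hi, rfl⟩, hle'⟩ := h η (by simp [termVec, MvPolynomial.coeff_monomial])
  refine hi (hq i fun h0 => ?_)
  have := hle' i
  rw [Finsupp.single_eq_same, h0] at this
  omega

/-- The terms allowed in a pre-syzygy are exactly those that reduction of `x_i F_t` can produce. -/
lemma setOf_syzTerm_eq (p : NonMult P) :
    {q : Term n P | q.1 ∈ slicedMultipliers p.1.2 q.2.1.1 ∧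
      tdeg (degOne d P) q = degOne d P p.1.1 + 1 ∧ q ∈ sousEscalier (UOne K P)} =
      multTermsBelow d P (Finsupp.single p.1.2 1) (degOne d P p.1.1 + 1) := by
  ext q
  constructor
  · rintro ⟨h1, h2, -⟩
    exact ⟨fun j hj => (h1 j hj).2, colex_lt_single fun j hj => (h1 j hj).1, h2⟩
  · rintro ⟨h1, h2, h3⟩
    exact ⟨fun j hj => ⟨eq_zero_of_colex_lt_single h2 hj, h1 j hj⟩, h3, mem_sousEscalier_UOne h1⟩

/-- The tail of the pre-syzygy with the values `b` of the parameters `B`. -/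
def syzTail (K : Type u) [Field K] (d : Fin m → ℤ) (P : Finset (Term n (Fin m)))
    (b : BParam K d P → A) (p : NonMult P) : Vec n P A :=
  ∑ q : SyzTerm K d p, b ⟨p, q⟩ • termVec A q.1

lemma preSyz_eq (b : BParam K d P → A) (p : NonMult P) :
    preSyz K d P b p = termVec A (Finsupp.single p.1.2 1, p.1.1) - syzTail K d P b p := rfl

lemma syzTail_mem_multTermsBelow (b : BParam K d P → A) (p : NonMult P) :
    syzTail K d P b p ∈
      termSpan A (multTermsBelow d P (Finsupp.single p.1.2 1) (degOne d P p.1.1 + 1)) := by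
  rw [← setOf_syzTerm_eq (K := K)]
  exact sum_subtype_mem_termSpan _

lemma syzTail_mem (b : BParam K d P → A) (p : NonMult P) :
    syzTail K d P b p ∈ termSpan A (multTerms P) :=
  termSpan_mono (fun _ h => h.1) (syzTail_mem_multTermsBelow b p)

lemma syzTail_injective {b b' : BParam K d P → A}
    (h : ∀ p, syzTail K d P b p = syzTail K d P b' p) : b = b' := by
  funext ⟨p, q⟩
  have := congrArg (coeffAt q.1) (h p)
  unfold syzTail at this
  rwa [coeffAt_sum_subtype (fun q => b ⟨p, q⟩), coeffAt_sum_subtype (fun q => b' ⟨p, q⟩)] at this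

lemma partialZero_preSyz (c : CParam d U P → A) (b : BParam K d P → A) (p : NonMult P) :
    partialZero (markedSet d U P c) (preSyz K d P b p) =
      (MvPolynomial.X p.1.2 : PolyRing n A) • markedSet d U P c p.1.1 -
        partialZero (markedSet d U P c) (syzTail K d P b p) := by
  rw [preSyz_eq, map_sub, partialZero_termVec]
  rfl

/-- There are values of the parameters `B` for which the pre-syzygies yield the normal forms of the
elements `x_i F_t`. -/
lemma exists_partialZero_preSyz_mem (hP : IsPommaretBasis U P) (c : CParam d U P → A) :
    ∃ b : BParam K d P → A, ∀ p, partialZero (markedSet d U P c) (preSyz K d P b p) ∈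
      termSpan A (sousEscalierDeg d U (degOne d P p.1.1 + 1)) := by
  choose Q hQ g hg h using fun p : NonMult P => mem_normalSpan.1 (X_smul_mem_normalSpan hP c p)
  -- The values are the coefficients of the multiplicative part `Q` of the normal form of `x_i F_t`.
  refine ⟨fun b => coeffAt b.2.1 (Q b.1), fun p => ?_⟩
  have hQp := hQ p
  rw [← setOf_syzTerm_eq (K := K)] at hQp
  have : syzTail K d P (fun b => coeffAt b.2.1 (Q b.1)) p = Q p := (eq_sum_subtype hQp).symm
  rw [partialZero_preSyz, this, h p, add_sub_cancel_left]
  exact hg p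

/-- The writing `x_i F_t = ∑ Q_γ F_γ + g` is unique. -/
lemma syzTail_eq_of_partialZero_mem (hP : IsPommaretBasis U P) {c : CParam d U P → A}
    {b : BParam K d P → A} {p : NonMult P}
    (hb : partialZero (markedSet d U P c) (preSyz K d P b p) ∈ termSpan A (sousEscalier U))
    {Q : Vec n P A} (hQ : Q ∈ termSpan A (multTerms P)) {g : Vec n (Fin m) A}
    (hg : g ∈ termSpan A (sousEscalier U))
    (h : (MvPolynomial.X p.1.2 : PolyRing n A) • markedSet d U P c p.1.1 =
      partialZero (markedSet d U P c) Q + g) :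
    syzTail K d P b p = Q ∧ partialZero (markedSet d U P c) (preSyz K d P b p) = g := by
  rw [partialZero_preSyz, h] at hb ⊢
  have h0 : Q - syzTail K d P b p = 0 := by
    refine eq_zero_of_partialZero_mem hP c (sub_mem hQ (syzTail_mem b p)) ?_
    rw [map_sub]
    convert sub_mem hb hg using 1
    abel
  have h1 : Q = syzTail K d P b p := sub_eq_zero.1 h0
  exact ⟨h1.symm, by rw [← h1]; abel⟩

lemma eq_of_partialZero_preSyz_mem (hP : IsPommaretBasis U P) {c : CParam d U P → A}
    {b b' : BParam K d P → A}
    (hb : ∀ p, partialZero (markedSet d U P c) (preSyz K d P b p) ∈ termSpan A (sousEscalier U))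
    (hb' : ∀ p, partialZero (markedSet d U P c) (preSyz K d P b' p) ∈
      termSpan A (sousEscalier U)) : b = b' := by
  refine syzTail_injective fun p => (syzTail_eq_of_partialZero_mem hP (hb p) (syzTail_mem b' p)
    (hb' p) ?_).1
  rw [partialZero_preSyz]
  abel

/-- Modulo the pre-syzygies, every element of the free module is congruent to a family of
polynomials in multiplicative variables. -/
lemma span_preSyz_sup (b : BParam K d P → A) :
    (Submodule.span (PolyRing n A) (Set.range (preSyz K d P b))).restrictScalars A ⊔
      termSpan A (multTerms P) = ⊤ := by
  rw [eq_top_iff, ← termSpan_univ]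
  refine Submodule.span_le.2 ?_
  rintro _ ⟨⟨η, t⟩, -, rfl⟩
  induction η using colex_induction generalizing t with
  | h η ih =>
  by_cases hη : η ∈ multipliers t.1.1
  · exact Submodule.mem_sup_right (termVec_mem_termSpan hη)
  obtain ⟨i, hi0, hi⟩ : ∃ i, η i ≠ 0 ∧ ¬ IsMult t.1.1 i := by
    by_contra h
    push Not at h
    exact hη h
  obtain ⟨δ, rfl⟩ : ∃ δ, η = δ + Finsupp.single i 1 :=
    ⟨η - Finsupp.single i 1, (tsub_add_cancel_of_le
      (Finsupp.single_le_iff.2 (Nat.one_le_iff_ne_zero.2 hi0))).symm⟩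
  let p : NonMult P := ⟨(t, i), hi⟩
  have h1 : (MvPolynomial.monomial δ 1 : PolyRing n A) • preSyz K d P b p =
      termVec A (δ + Finsupp.single i 1, t) -
        ∑ q : SyzTerm K d p, b ⟨p, q⟩ • termVec A (δ + q.1.1, q.1.2) := by
    rw [preSyz, smul_sub, monomial_smul_termVec, one_smul, Finset.smul_sum]
    congr 1
    refine Finset.sum_congr rfl fun q _ => ?_
    rw [smul_comm, monomial_smul_termVec, one_smul]
  -- Subtracting `x^δ` times the pre-syzygy replaces the factor `x_i` by products of smaller
  -- variables. This lowers the cofactor in the colexicographic order, even if its degree grows.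
  rw [← sub_add_cancel (termVec A (δ + Finsupp.single i 1, t))
    (∑ q : SyzTerm K d p, b ⟨p, q⟩ • termVec A (δ + q.1.1, q.1.2)), ← h1]
  refine add_mem (Submodule.mem_sup_left ?_) (Submodule.sum_mem _ fun q _ =>
    Submodule.smul_mem _ _ (ih _ (colex_add_lt_add (colex_lt_single fun j hj => (q.2.1 j hj).1) δ) _))
  exact (Submodule.span (PolyRing n A) _).smul_mem _ (Submodule.subset_span (Set.mem_range_self p))

end preSyzygies

/-! ### Marked bases and their syzygies -/

section bases

variable {n m : ℕ} {K : Type u} [Field K] {A : Type u} [CommRing A]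
  {d : Fin m → ℤ} {U : Submodule (PolyRing n K) (Vec n (Fin m) K)} {P : Finset (Term n (Fin m))}

lemma isMarkedSet_markedSet (hP : IsPommaretBasis U P) (c : CParam d U P → A) :
    IsMarkedSet d U P (markedSet d U P c) := by
  intro t
  have htail : termVec A t.1 - markedSet d U P c t ∈
      termSpan A (sousEscalierDeg d U (tdeg d t.1)) := by
    rw [markedSet, sub_sub_cancel]
    exact sum_subtype_mem_termSpan _
  have hcoeff : ∀ s, coeffAt s (markedSet d U P c t) = coeffAt s (termVec A t.1) -
      coeffAt s (termVec A t.1 - markedSet d U P c t) := fun s => by simp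
  rw [mem_termSpan] at htail
  refine ⟨?_, fun s hs => ?_, fun s hst hs => ?_⟩
  · rw [hcoeff, coeffAt_termVec_self, sub_eq_self]
    by_contra h
    exact mem_not_mem_sousEscalier hP t (htail _ h).1
  · by_cases hst : s = t.1
    · rw [hst]
    · rw [hcoeff, coeffAt_termVec_of_ne fun h => hst h.symm, zero_sub, neg_ne_zero] at hs
      exact (htail s hs).2
  · rw [hcoeff, coeffAt_termVec_of_ne fun h => hst h.symm, zero_sub, neg_ne_zero] at hs
    exact (htail s hs).1

lemma exists_markedSet_eq_of_sub_mem {F : P → Vec n (Fin m) A}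
    (h : ∀ t : P, termVec A t.1 - F t ∈ termSpan A (sousEscalierDeg d U (tdeg d t.1))) :
    ∃ c : CParam d U P → A, F = markedSet d U P c := by
  refine ⟨fun c => coeffAt c.2.1 (termVec A c.1.1 - F c.1), funext fun t => ?_⟩
  have := eq_sum_subtype (p := fun s => s ∈ sousEscalier U ∧ tdeg d s = tdeg d t.1) (h t)
  rw [markedSet, ← this, sub_sub_cancel]

lemma IsMarkedSet.exists_eq_markedSet {F : P → Vec n (Fin m) A} (h : IsMarkedSet d U P F) :
    ∃ c : CParam d U P → A, F = markedSet d U P c := by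
  refine exists_markedSet_eq_of_sub_mem fun t => mem_termSpan.2 fun s hs => ?_
  obtain ⟨h1, h2, h3⟩ := h t
  by_cases hst : s = t.1
  · subst hst
    simp [h1] at hs
  · rw [coeffAt_sub, coeffAt_termVec_of_ne fun h => hst h.symm, zero_sub, neg_ne_zero] at hs
    exact ⟨h3 s hst hs, h2 s hs⟩

lemma markedSet_sub_mem (c : CParam d U P → A) (t : P) :
    termVec A t.1 - markedSet d U P c t ∈ termSpan A (sousEscalier U) := by
  rw [markedSet, sub_sub_cancel]
  exact termSpan_mono (fun _ h => h.1) (sum_subtype_mem_termSpan (p := fun s =>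
    s ∈ sousEscalier U ∧ tdeg d s = tdeg d t.1) _)

lemma markedSet_injective {c c' : CParam d U P → A}
    (h : markedSet d U P c = markedSet d U P c') : c = c' := by
  funext ⟨t, s⟩
  have := congrArg (coeffAt s.1) (sub_right_injective (congrFun h t))
  rwa [coeffAt_sum_subtype (fun s => c ⟨t, s⟩), coeffAt_sum_subtype (fun s => c' ⟨t, s⟩)] at this

lemma partialZero_mem_span (F : P → Vec n (Fin m) A) (v : Vec n P A) :
    partialZero F v ∈ Submodule.span (PolyRing n A) (Set.range F) := by
  rw [partialZero_apply]
  exact Submodule.sum_mem _ fun γ _ =>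
    Submodule.smul_mem _ _ (Submodule.subset_span ⟨γ, rfl⟩)

lemma range_partialZero (F : P → Vec n (Fin m) A) :
    LinearMap.range (partialZero F) = Submodule.span (PolyRing n A) (Set.range F) :=
  Fintype.range_linearCombination _ _

/-- The values `c`, `b` of the parameters satisfy the equations that define `𝒮`. -/
def IsSyzSolution (c : CParam d U P → A) (b : BParam K d P → A) : Prop :=
  ∀ p, partialZero (markedSet d U P c) (preSyz K d P b p) = 0

variable {c : CParam d U P → A} {b : BParam K d P → A}

lemma IsSyzSolution.span_preSyz_le (h : IsSyzSolution c b) :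
    Submodule.span (PolyRing n A) (Set.range (preSyz K d P b)) ≤ syz (markedSet d U P c) := by
  refine Submodule.span_le.2 ?_
  rintro _ ⟨p, rfl⟩
  exact h p

/-- The reduction by pre-syzygies does not change the image under `∂₀`, so every element of `(F)` is
a multiplicative combination and uniqueness of normal forms applies to it. -/
lemma IsSyzSolution.exists_mult (h : IsSyzSolution c b) (v : Vec n P A) :
    ∃ z ∈ Submodule.span (PolyRing n A) (Set.range (preSyz K d P b)),
      ∃ Q ∈ termSpan A (multTerms P), z + Q = v ∧
        partialZero (markedSet d U P c) v = partialZero (markedSet d U P c) Q := by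
  obtain ⟨z, hz, Q, hQ, rfl⟩ := Submodule.mem_sup.1 (span_preSyz_sup b ▸ Submodule.mem_top (x := v))
  have hz0 : partialZero (markedSet d U P c) z = 0 := h.span_preSyz_le hz
  exact ⟨z, hz, Q, hQ, rfl, by rw [map_add, hz0, zero_add]⟩

/-- A syzygy reduces to a multiplicative family that is itself a syzygy, and such a family vanishes
by uniqueness of normal forms. -/
lemma IsSyzSolution.syz_eq (hP : IsPommaretBasis U P) (h : IsSyzSolution c b) :
    syz (markedSet d U P c) = Submodule.span (PolyRing n A) (Set.range (preSyz K d P b)) := by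
  refine le_antisymm (fun v hv => ?_) h.span_preSyz_le
  obtain ⟨z, hz, Q, hQ, rfl, hQ0⟩ := h.exists_mult v
  have hv0 : partialZero (markedSet d U P c) (z + Q) = 0 := hv
  rw [eq_zero_of_partialZero_mem hP c hQ (by rw [← hQ0, hv0]; exact zero_mem _), add_zero]
  exact hz

/-- The sum is everything because normal forms exist. The intersection is zero because a
multiplicative combination in `⟨N(U)⟩` has zero cofactors. -/
lemma IsSyzSolution.isCompl (hP : IsPommaretBasis U P) (h : IsSyzSolution c b) :
    IsCompl ((Submodule.span (PolyRing n A) (Set.range (markedSet d U P c))).restrictScalars A)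
      (termSpan A (sousEscalier U)) := by
  refine ⟨Submodule.disjoint_def.2 fun f hf hfN => ?_, codisjoint_iff_le_sup.2 ?_⟩
  · rw [Submodule.restrictScalars_mem, ← range_partialZero] at hf
    obtain ⟨v, rfl⟩ := hf
    obtain ⟨z, hz, Q, hQ, -, hQv⟩ := h.exists_mult v
    rw [hQv] at hfN ⊢
    rw [eq_zero_of_partialZero_mem hP c hQ hfN, map_zero]
  · rw [← normalSpan_eq_top hP c, normalSpan]
    refine sup_le_sup_right ?_ _
    rintro _ ⟨Q, -, rfl⟩
    exact partialZero_mem_span _ _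

/-- To split degree by degree, a homogeneous element is written with a homogeneous normal form of
the same degree; the remaining summand in `(F)` is then homogeneous as a difference. -/
lemma isMarkedBasis_of_isCompl (hP : IsPommaretBasis U P)
    (h : IsCompl ((Submodule.span (PolyRing n A)
      (Set.range (markedSet d U P c))).restrictScalars A) (termSpan A (sousEscalier U))) :
    IsMarkedBasis d U P (markedSet d U P c) := by
  refine ⟨isMarkedSet_markedSet hP c, fun s => ⟨le_antisymm (sup_le inf_le_right ?_) ?_,
    h.disjoint.mono inf_le_left (termSpan_mono fun _ ht => ht.1)⟩⟩
  · rw [degPiece_eq_termSpan]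
    exact termSpan_mono fun _ ht => ht.2
  · intro f hf
    obtain ⟨Q, hQ, g, hg, rfl⟩ := mem_normalSpan.1 (mem_normalSpan_of_mem_degPiece hP c hf)
    refine Submodule.add_mem_sup ⟨partialZero_mem_span _ _, ?_⟩ hg
    have : g ∈ degPiece A d s := by
      rw [degPiece_eq_termSpan]
      exact termSpan_mono (fun _ ht => ht.2) hg
    simpa using sub_mem hf this

/-- The image of the pre-syzygy lies in `(F)` and in `⟨N(U)⟩`, in the same degree, and a marked
basis makes these disjoint. -/
lemma isSyzSolution_of_isMarkedBasis (h : IsMarkedBasis d U P (markedSet d U P c))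
    (hb : ∀ p, partialZero (markedSet d U P c) (preSyz K d P b p) ∈
      termSpan A (sousEscalierDeg d U (degOne d P p.1.1 + 1))) : IsSyzSolution c b := by
  refine fun p => Submodule.disjoint_def.1 (h.2 _).2 _ ⟨partialZero_mem_span _ _, ?_⟩ (hb p)
  rw [degPiece_eq_termSpan]
  exact termSpan_mono (fun _ ht => ht.2) (hb p)

lemma IsSyzSolution.isFundamentalSyzygy (h : IsSyzSolution c b) (p : NonMult P) :
    IsFundamentalSyzygy (markedSet d U P c) p (preSyz K d P b p) := by
  refine ⟨syzTail K d P b p, isMultFamily_iff.2 (syzTail_mem b p), ?_, preSyz_eq b p⟩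
  have := h p
  rwa [partialZero_preSyz, sub_eq_zero] at this

lemma partialZero_eq_zero_of_isFundamentalSyzygy {F : P → Vec n (Fin m) A} {p : NonMult P}
    {z : Vec n P A} (h : IsFundamentalSyzygy F p z) : partialZero F z = 0 := by
  obtain ⟨Q, -, hQ, rfl⟩ := h
  rw [map_sub, partialZero_termVec, partialZero_apply, ← hQ, sub_eq_zero]
  rfl

lemma isGraded_span_markedSet (hP : IsPommaretBasis U P) (c : CParam d U P → A) :
    IsGraded d (Submodule.span (PolyRing n A) (Set.range (markedSet d U P c))) := by
  refine le_antisymm (Submodule.span_le.2 fun f hf => hf.1) (Submodule.span_mono ?_)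
  rintro _ ⟨t, rfl⟩
  exact ⟨Submodule.subset_span ⟨t, rfl⟩, _, (isMarkedSet_markedSet hP c t).2.1⟩

/-- The heads cancel in the difference of two such elements, which leaves an element of `M ∩
⟨N(U)⟩`. -/
lemma markedSet_eq_of_mem {M : Submodule (PolyRing n A) (Vec n (Fin m) A)}
    (hM : Disjoint (M.restrictScalars A) (termSpan A (sousEscalier U)))
    {c c' : CParam d U P → A} (h : ∀ t, markedSet d U P c t ∈ M)
    (h' : ∀ t, markedSet d U P c' t ∈ M) : c = c' := by
  refine markedSet_injective (funext fun t => sub_eq_zero.1 ?_)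
  refine Submodule.disjoint_def.1 hM _ (M.sub_mem (h t) (h' t)) ?_
  convert sub_mem (markedSet_sub_mem c' t) (markedSet_sub_mem c t) using 1
  abel

end bases

/-! ### Homogeneous components of elements of graded submodules -/

section graded

variable {n : ℕ} {ι : Type} {A : Type u} [CommRing A]

/-- The component of degree `s` of an element of `R_A ^ ι(-d)`. -/
def degProj (d : ι → ℤ) (s : ℤ) (f : Vec n ι A) : Vec n ι A := fun k =>
  ∑ β ∈ (f k).support with tdeg d (β, k) = s, MvPolynomial.monomial β ((f k).coeff β)

lemma coeffAt_degProj (d : ι → ℤ) (s : ℤ) (f : Vec n ι A) (t : Term n ι) :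
    coeffAt t (degProj d s f) = if tdeg d t = s then coeffAt t f else 0 := by
  classical
  obtain ⟨α, k⟩ := t
  simp only [coeffAt, degProj, MvPolynomial.coeff_sum, MvPolynomial.coeff_monomial]
  rw [Finset.sum_ite_eq' _ α]
  by_cases h : tdeg d (α, k) = s
  · by_cases h0 : MvPolynomial.coeff α (f k) = 0 <;> simp [h, h0]
  · simp [h]

lemma degProj_of_mem (d : ι → ℤ) {s : ℤ} {f : Vec n ι A} (hf : f ∈ degPiece A d s) :
    degProj d s f = f := by
  refine vec_ext fun t => ?_
  rw [coeffAt_degProj]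
  split_ifs with h
  · rfl
  · by_contra h'
    exact h (hf t (Ne.symm h'))

lemma degProj_of_mem_of_ne (d : ι → ℤ) {s s' : ℤ} (hs : s' ≠ s) {f : Vec n ι A}
    (hf : f ∈ degPiece A d s') : degProj d s f = 0 := by
  refine vec_ext fun t => ?_
  rw [coeffAt_degProj, coeffAt_zero]
  split_ifs with h
  · by_contra h'
    exact hs ((hf t h').symm.trans h)
  · rfl

lemma degProj_add (d : ι → ℤ) (s : ℤ) (f g : Vec n ι A) :
    degProj d s (f + g) = degProj d s f + degProj d s g := by
  refine vec_ext fun t => ?_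
  simp only [coeffAt_degProj, coeffAt_add]
  split_ifs <;> simp

lemma degProj_zero (d : ι → ℤ) (s : ℤ) : degProj d s (0 : Vec n ι A) = 0 :=
  vec_ext fun t => by simp [coeffAt_degProj]

lemma coeffAt_monomial_smul (η : Mon n) (a : A) (f : Vec n ι A) (t : Term n ι) :
    coeffAt t ((MvPolynomial.monomial η a : PolyRing n A) • f) =
      if η ≤ t.1 then a * coeffAt (t.1 - η, t.2) f else 0 := by
  simp only [coeffAt, Pi.smul_apply, smul_eq_mul]
  exact MvPolynomial.coeff_monomial_mul' _ _ _ _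

lemma degProj_monomial_smul (d : ι → ℤ) (s : ℤ) (η : Mon n) (a : A) (f : Vec n ι A) :
    degProj d s ((MvPolynomial.monomial η a : PolyRing n A) • f) =
      (MvPolynomial.monomial η a : PolyRing n A) • degProj d (s - (η.degree : ℤ)) f := by
  refine vec_ext fun t => ?_
  simp only [coeffAt_degProj, coeffAt_monomial_smul]
  by_cases h : η ≤ t.1
  · have hdeg : tdeg d t = (η.degree : ℤ) + tdeg d (t.1 - η, t.2) := by
      rw [← tdeg_add, add_tsub_cancel_of_le h]
    have hiff : tdeg d t = s ↔ tdeg d (t.1 - η, t.2) = s - (η.degree : ℤ) := by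
      rw [hdeg]
      omega
    simp only [h, if_true, hiff]
    split_ifs <;> simp
  · simp [h]

/-- Being generated by homogeneous elements implies closure under components. Scalars are reduced to
monomials, which shift the degree; hence the induction is uniform in `s`. -/
lemma IsGraded.degProj_mem {d : ι → ℤ} {M : Submodule (PolyRing n A) (Vec n ι A)}
    (hM : IsGraded d M) {f : Vec n ι A} (hf : f ∈ M) (s : ℤ) : degProj d s f ∈ M := by
  rw [← hM] at hf
  induction hf using Submodule.span_induction generalizing s with
  | mem x hx =>
    obtain ⟨hxM, s', hx⟩ := hx
    by_cases h : s' = s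
    · rwa [degProj_of_mem d (h ▸ hx)]
    · rw [degProj_of_mem_of_ne d h hx]
      exact zero_mem _
  | zero =>
    rw [degProj_zero]
    exact zero_mem _
  | add x y _ _ hx hy =>
    rw [degProj_add]
    exact add_mem (hx s) (hy s)
  | smul a x _ hx =>
    induction a using MvPolynomial.induction_on' generalizing s with
    | monomial η r =>
      rw [degProj_monomial_smul]
      exact M.smul_mem _ (hx _)
    | add p q hp hq =>
      rw [add_smul, degProj_add]
      exact add_mem (hp s) (hq s)

end graded

/-! ### Elements of the two functors as solutions of the syzygy equations -/

section modules

variable {n m : ℕ} {K : Type u} [Field K] {A : Type u} [CommRing A]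
  {d : Fin m → ℤ} {U : Submodule (PolyRing n K) (Vec n (Fin m) K)} {P : Finset (Term n (Fin m))}

/-- A graded complement of `⟨N(U)⟩` is generated by a marked set. -/
lemma exists_markedSet_of_isCompl (hP : IsPommaretBasis U P)
    {M : Submodule (PolyRing n A) (Vec n (Fin m) A)} (hM : IsGraded d M)
    (hc : IsCompl (M.restrictScalars A) (termSpan A (sousEscalier U))) :
    ∃ c : CParam d U P → A,
      M = Submodule.span (PolyRing n A) (Set.range (markedSet d U P c)) := by
  have hF : ∀ t : P, ∃ f ∈ M, termVec A t.1 - f ∈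
      termSpan A (sousEscalierDeg d U (tdeg d t.1)) := by
    intro t
    obtain ⟨f, hf, g, hg, hfg⟩ := Submodule.mem_sup.1
      (codisjoint_iff.1 hc.codisjoint ▸ Submodule.mem_top (x := termVec A t.1))
    -- The component of `t` along `M` need not be known to be homogeneous; its part in the degree of
    -- `t` still lies in `M`, as `M` is graded.
    refine ⟨degProj d (tdeg d t.1) f, hM.degProj_mem hf _, ?_⟩
    have ht : termVec A t.1 ∈ degPiece A d (tdeg d t.1) := by
      rw [degPiece_eq_termSpan]
      exact termVec_mem_termSpan rfl
    have h := congrArg (degProj d (tdeg d t.1)) hfg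
    rw [degProj_add, degProj_of_mem d ht] at h
    rw [← h, add_sub_cancel_left, mem_termSpan]
    intro s hs
    rw [coeffAt_degProj] at hs
    split_ifs at hs with h'
    · exact ⟨mem_termSpan.1 hg s hs, h'⟩
    · exact absurd rfl hs
  choose F hFM hF using hF
  obtain ⟨c, rfl⟩ := exists_markedSet_eq_of_sub_mem hF
  refine ⟨c, le_antisymm (fun f hf => ?_) (Submodule.span_le.2 ?_)⟩
  -- The normal form `g` of an element of `M` lies in `M ∩ ⟨N(U)⟩`, so it is zero.
  · obtain ⟨Q, hQ, g, hg, rfl⟩ := mem_normalSpan.1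
      (normalSpan_eq_top hP c ▸ Submodule.mem_top (x := f))
    have hle : Submodule.span (PolyRing n A) (Set.range (markedSet d U P c)) ≤ M := by
      refine Submodule.span_le.2 ?_
      rintro _ ⟨t, rfl⟩
      exact hFM t
    have hgM : g ∈ M := by
      simpa using sub_mem hf (hle (partialZero_mem_span (markedSet d U P c) Q))
    rw [Submodule.disjoint_def.1 hc.disjoint g hgM hg, add_zero]
    exact partialZero_mem_span _ _
  · rintro _ ⟨t, rfl⟩
    exact hFM t

lemma exists_isSyzSolution_of_isMarkedBasis (hP : IsPommaretBasis U P) {c : CParam d U P → A}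
    (h : IsMarkedBasis d U P (markedSet d U P c)) :
    ∃ b : BParam K d P → A, IsSyzSolution c b := by
  obtain ⟨b, hb⟩ := exists_partialZero_preSyz_mem hP c
  exact ⟨b, isSyzSolution_of_isMarkedBasis h hb⟩

/-- The module determines its marked set, and uniqueness of normal forms then determines the
pre-syzygies. This is the injectivity in both representability statements. -/
lemma IsSyzSolution.eq_of_span_eq (hP : IsPommaretBasis U P) {c c' : CParam d U P → A}
    {b b' : BParam K d P → A} (h : IsSyzSolution c b) (h' : IsSyzSolution c' b')
    (heq : Submodule.span (PolyRing n A) (Set.range (markedSet d U P c)) =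
      Submodule.span (PolyRing n A) (Set.range (markedSet d U P c'))) : c = c' ∧ b = b' := by
  have hc : c = c' := markedSet_eq_of_mem (h.isCompl hP).disjoint
    (fun t => Submodule.subset_span ⟨t, rfl⟩)
    (fun t => heq ▸ Submodule.subset_span ⟨t, rfl⟩)
  subst hc
  refine ⟨rfl, eq_of_partialZero_preSyz_mem hP (c := c) (fun p => ?_) fun p => ?_⟩
  · rw [h p]
    exact zero_mem _
  · rw [h' p]
    exact zero_mem _

/-- With the analogue for pairs below, this replaces both functors by the solutions of one system of
polynomial equations. Stability under extension of scalars and representability then become formal.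
-/
lemma mem_markedModules_iff (hP : IsPommaretBasis U P) (A : NoethAlg K)
    (M : Submodule (PolyRing n A.obj) (Vec n (Fin m) A.obj)) :
    M ∈ markedModules d U A ↔ ∃ (c : CParam d U P → A.obj) (b : BParam K d P → A.obj),
      IsSyzSolution c b ∧
        Submodule.span (PolyRing n A.obj) (Set.range (markedSet d U P c)) = M := by
  constructor
  · rintro ⟨hM, hc⟩
    obtain ⟨c, rfl⟩ := exists_markedSet_of_isCompl hP hM hc
    obtain ⟨b, hb⟩ := exists_isSyzSolution_of_isMarkedBasis hP (isMarkedBasis_of_isCompl hP hc)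
    exact ⟨c, b, hb, rfl⟩
  · rintro ⟨c, b, h, rfl⟩
    exact ⟨isGraded_span_markedSet hP c, h.isCompl hP⟩

lemma mem_markedSyzygies_iff (hP : IsPommaretBasis U P) (A : NoethAlg K)
    (x : Submodule (PolyRing n A.obj) (Vec n (Fin m) A.obj) ×
      Submodule (PolyRing n A.obj) (Vec n P A.obj)) :
    x ∈ markedSyzygies d U P A ↔ ∃ (c : CParam d U P → A.obj) (b : BParam K d P → A.obj),
      IsSyzSolution c b ∧
        (Submodule.span (PolyRing n A.obj) (Set.range (markedSet d U P c)),
          Submodule.span (PolyRing n A.obj) (Set.range (preSyz K d P b))) = x := by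
  obtain ⟨M, S⟩ := x
  constructor
  · rintro ⟨hM, F, hF, rfl, rfl⟩
    obtain ⟨c, rfl⟩ := hF.1.exists_eq_markedSet
    obtain ⟨b, hb⟩ := exists_isSyzSolution_of_isMarkedBasis hP hF
    exact ⟨c, b, hb, Prod.ext rfl (hb.syz_eq hP).symm⟩
  · rintro ⟨c, b, h, heq⟩
    cases heq
    exact ⟨(mem_markedModules_iff hP A _).2 ⟨c, b, h, rfl⟩, markedSet d U P c,
      isMarkedBasis_of_isCompl hP (h.isCompl hP), rfl, (h.syz_eq hP).symm⟩

end modules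

/-! ### Extension of scalars -/

section extension

variable {n : ℕ} {ι : Type} {A A' : Type u} [CommRing A] [CommRing A'] (σ : A →+* A')

@[simp] lemma coeffAt_mapVec (t : Term n ι) (f : Vec n ι A) :
    coeffAt t (mapVec σ f) = σ (coeffAt t f) :=
  MvPolynomial.coeff_map _ _ _

lemma mapVec_sub (f g : Vec n ι A) : mapVec σ (f - g) = mapVec σ f - mapVec σ g :=
  vec_ext fun t => by simp

lemma mapVec_add (f g : Vec n ι A) : mapVec σ (f + g) = mapVec σ f + mapVec σ g :=
  vec_ext fun t => by simp

lemma mapVec_zero : mapVec σ (0 : Vec n ι A) = 0 := vec_ext fun t => by simp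

lemma mapVec_sum {κ : Type*} (s : Finset κ) (f : κ → Vec n ι A) :
    mapVec σ (∑ k ∈ s, f k) = ∑ k ∈ s, mapVec σ (f k) :=
  vec_ext fun t => by simp [coeffAt_sum]

lemma mapVec_smul (a : A) (f : Vec n ι A) : mapVec σ (a • f) = σ a • mapVec σ f :=
  vec_ext fun t => by simp

lemma mapVec_polynomial_smul (a : PolyRing n A) (f : Vec n ι A) :
    mapVec σ (a • f) = MvPolynomial.map σ a • mapVec σ f := by
  funext k
  simp [mapVec]

lemma mapVec_termVec [DecidableEq ι] (t : Term n ι) :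
    mapVec σ (termVec A t) = termVec A' t := by
  classical
  refine vec_ext fun s => ?_
  rw [coeffAt_mapVec, coeffAt_termVec, coeffAt_termVec]
  split_ifs <;> simp

lemma mapVec_mem_termSpan [DecidableEq ι] [Finite ι] {T : Set (Term n ι)} {f : Vec n ι A}
    (hf : f ∈ termSpan A T) : mapVec σ f ∈ termSpan A' T := by
  rw [mem_termSpan] at hf ⊢
  refine fun t ht => hf t fun h => ht ?_
  rw [coeffAt_mapVec, h, map_zero]

lemma extendScalars_span_range {κ : Type*} (G : κ → Vec n ι A) :
    extendScalars σ (Submodule.span (PolyRing n A) (Set.range G)) =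
      Submodule.span (PolyRing n A') (Set.range fun k => mapVec σ (G k)) := by
  refine le_antisymm (Submodule.span_le.2 ?_) (Submodule.span_le.2 ?_)
  · rintro _ ⟨f, hf, rfl⟩
    induction hf using Submodule.span_induction with
    | mem x hx =>
      obtain ⟨k, rfl⟩ := hx
      exact Submodule.subset_span ⟨k, rfl⟩
    | zero =>
      rw [mapVec_zero]
      exact zero_mem _
    | add x y _ _ hx hy =>
      rw [mapVec_add]
      exact add_mem hx hy
    | smul a x _ hx =>
      rw [mapVec_polynomial_smul]
      exact Submodule.smul_mem _ _ hx
  · rintro _ ⟨k, rfl⟩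
    exact Submodule.subset_span ⟨G k, Submodule.subset_span ⟨k, rfl⟩, rfl⟩

variable {m : ℕ} {K : Type u} [Field K] {d : Fin m → ℤ}
  {U : Submodule (PolyRing n K) (Vec n (Fin m) K)} {P : Finset (Term n (Fin m))}

lemma mapVec_markedSet (c : CParam d U P → A) (t : P) :
    mapVec σ (markedSet d U P c t) = markedSet d U P (fun x => σ (c x)) t := by
  simp only [markedSet, mapVec_sub, mapVec_sum, mapVec_smul, mapVec_termVec]

lemma mapVec_preSyz (b : BParam K d P → A) (p : NonMult P) :
    mapVec σ (preSyz K d P b p) = preSyz K d P (fun x => σ (b x)) p := by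
  simp only [preSyz, mapVec_sub, mapVec_sum, mapVec_smul, mapVec_termVec]

lemma mapVec_partialZero (c : CParam d U P → A) (v : Vec n P A) :
    mapVec σ (partialZero (markedSet d U P c) v) =
      partialZero (markedSet d U P fun x => σ (c x)) (mapVec σ v) := by
  simp only [partialZero_apply, mapVec_sum, mapVec_polynomial_smul, mapVec_markedSet]
  rfl

lemma mapVec_partialZero_preSyz (c : CParam d U P → A) (b : BParam K d P → A) (p : NonMult P) :
    mapVec σ (partialZero (markedSet d U P c) (preSyz K d P b p)) =
      partialZero (markedSet d U P fun x => σ (c x)) (preSyz K d P (fun x => σ (b x)) p) := by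
  rw [mapVec_partialZero, mapVec_preSyz]

lemma IsSyzSolution.map {c : CParam d U P → A} {b : BParam K d P → A} (h : IsSyzSolution c b) :
    IsSyzSolution (fun x => σ (c x)) (fun x => σ (b x)) := by
  intro p
  rw [← mapVec_partialZero_preSyz, h p, mapVec_zero]

lemma extendScalars_markedSet (c : CParam d U P → A) :
    extendScalars σ (Submodule.span (PolyRing n A) (Set.range (markedSet d U P c))) =
      Submodule.span (PolyRing n A') (Set.range (markedSet d U P fun x => σ (c x))) := by
  rw [extendScalars_span_range]
  simp only [mapVec_markedSet]

lemma extendScalars_preSyz (b : BParam K d P → A) :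
    extendScalars σ (Submodule.span (PolyRing n A) (Set.range (preSyz K d P b))) =
      Submodule.span (PolyRing n A') (Set.range (preSyz K d P fun x => σ (b x))) := by
  rw [extendScalars_span_range]
  simp only [mapVec_preSyz]

end extension

/-! ### The ideals `𝒰` and `𝒮` -/

section ideals

variable {n m : ℕ} {K : Type u} [Field K] {d : Fin m → ℤ}
  {U : Submodule (PolyRing n K) (Vec n (Fin m) K)} {P : Finset (Term n (Fin m))}

/-- Taking coefficients commutes with `φ`, so the generators of `𝒮` vanish under `φ` exactly when
the specialised pre-syzygies are syzygies. -/
lemma idealS_le_ker_iff {A : Type u} [CommRing A] (φ : RingBC d U P →+* A) :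
    idealS d U P ≤ RingHom.ker φ ↔
      IsSyzSolution (d := d) (U := U) (P := P) (fun c => φ (MvPolynomial.X (Sum.inr c)))
        (fun b => φ (MvPolynomial.X (Sum.inl b))) := by
  have key : ∀ p t, φ (coeffAt t (partialZero (genericSetBC d U P) (genericPreSyz d U P p))) =
      coeffAt t (partialZero (markedSet d U P fun c => φ (MvPolynomial.X (Sum.inr c)))
        (preSyz K d P (fun b => φ (MvPolynomial.X (Sum.inl b))) p)) := fun p t => by
    rw [← mapVec_partialZero_preSyz φ, coeffAt_mapVec]
    rfl
  rw [idealS, Ideal.span_le]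
  constructor
  · refine fun h p => vec_ext fun t => ?_
    rw [← key, coeffAt_zero]
    exact h ⟨p, t, rfl⟩
  · rintro h _ ⟨p, t, rfl⟩
    rw [SetLike.mem_coe, RingHom.mem_ker, key, h p, coeffAt_zero]

/-- By uniqueness of normal forms, any `g` occurring in the definition of `𝒰` is the image of the
pre-syzygy with the generic values `b`. So the generators of `𝒰` are the coefficients of these
images. -/
lemma idealU_le_ker_iff (hP : IsPommaretBasis U P) {A : Type u} [CommRing A]
    (ψ : RingC d U P →+* A) {b : BParam K d P → RingC d U P}
    (hb : ∀ p, partialZero (genericSet d U P) (preSyz K d P b p) ∈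
      termSpan (RingC d U P) (sousEscalier U)) :
    idealU d U P ≤ RingHom.ker ψ ↔
      IsSyzSolution (d := d) (U := U) (P := P) (fun c => ψ (MvPolynomial.X c))
        (fun x => ψ (b x)) := by
  have key : ∀ p t, ψ (coeffAt t (partialZero (genericSet d U P) (preSyz K d P b p))) =
      coeffAt t (partialZero (markedSet d U P fun c => ψ (MvPolynomial.X c))
        (preSyz K d P (fun x => ψ (b x)) p)) := fun p t => by
    rw [← mapVec_partialZero_preSyz ψ, coeffAt_mapVec]
    rfl
  rw [idealU, Ideal.span_le]
  constructor
  · refine fun h p => vec_ext fun t => ?_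
    rw [← key, coeffAt_zero]
    refine h ⟨p, syzTail K d P b p, _, t, isMultFamily_iff.2 (syzTail_mem b p), hb p, ?_, rfl⟩
    rw [← partialZero_apply, genericSet, partialZero_preSyz]
    abel
  · rintro h _ ⟨p, Q, g, t, hQ, hg, hQg, rfl⟩
    rw [← (syzTail_eq_of_partialZero_mem hP (hb p) (isMultFamily_iff.1 hQ) hg hQg).2]
    change ψ (coeffAt t (partialZero (genericSet d U P) (preSyz K d P b p))) = 0
    rw [key, h p, coeffAt_zero]

/-- The values of the parameters `B` in a solution are determined by those of `C`, as the images of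
the coefficients in the generic normal forms. -/
lemma IsSyzSolution.eq_map (hP : IsPommaretBasis U P) {A : Type u} [CommRing A]
    (ψ : RingC d U P →+* A) {b : BParam K d P → RingC d U P}
    (hb : ∀ p, partialZero (genericSet d U P) (preSyz K d P b p) ∈
      termSpan (RingC d U P) (sousEscalier U)) {b' : BParam K d P → A}
    (h : IsSyzSolution (U := U) (fun c => ψ (MvPolynomial.X c)) b') : b' = fun x => ψ (b x) := by
  refine eq_of_partialZero_preSyz_mem hP (c := fun c => ψ (MvPolynomial.X c)) (fun p => ?_)
    fun p => ?_
  · rw [h p]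
    exact zero_mem _
  · rw [← mapVec_partialZero_preSyz ψ]
    exact mapVec_mem_termSpan ψ (hb p)

/-- The inclusion of `K[C]` in `K[B, C]` induces an isomorphism `K[C] / 𝒰 ≃ K[B, C] / 𝒮`. -/
lemma exists_quotient_algEquiv (hP : IsPommaretBasis U P) :
    ∃ e : (RingC d U P ⧸ idealU d U P) ≃ₐ[K] (RingBC d U P ⧸ idealS d U P),
      ∀ a, e (Ideal.Quotient.mk _ a) = Ideal.Quotient.mk _ (inclC d U P a) := by
  obtain ⟨b, hb⟩ := exists_partialZero_preSyz_mem (d := d) hP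
    (fun c => (MvPolynomial.X c : RingC d U P))
  replace hb : ∀ p, partialZero (genericSet d U P) (preSyz K d P b p) ∈
      termSpan (RingC d U P) (sousEscalier U) := fun p => termSpan_mono (fun _ h => h.1) (hb p)
  let f₁ : RingC d U P →ₐ[K] RingBC d U P ⧸ idealS d U P :=
    (Ideal.Quotient.mkₐ K (idealS d U P)).comp (inclC d U P)
  have hf₁X : ∀ c, f₁ (MvPolynomial.X c) =
      Ideal.Quotient.mk (idealS d U P) (MvPolynomial.X (Sum.inr c)) := fun c => by
    simp [f₁, inclC]
  have hS : IsSyzSolution (d := d) (U := U) (P := P) (fun c => f₁ (MvPolynomial.X c))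
      (fun x => Ideal.Quotient.mk (idealS d U P) (MvPolynomial.X (Sum.inl x))) := by
    simp only [hf₁X]
    exact (idealS_le_ker_iff (Ideal.Quotient.mk (idealS d U P))).1 (by rw [Ideal.mk_ker])
  -- In `K[B,C]/𝒮` each variable of `B` equals the image of its generic value, since a solution has
  -- only one possible `B`-part.
  have hf₁b := hS.eq_map hP f₁.toRingHom hb
  have hf₁ : idealU d U P ≤ RingHom.ker f₁.toRingHom := by
    rw [idealU_le_ker_iff hP f₁.toRingHom hb, ← hf₁b]
    exact hS
  -- The inverse substitutes the generic values `b` for the variables `B`.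
  let f₂ : RingBC d U P →ₐ[K] RingC d U P ⧸ idealU d U P :=
    MvPolynomial.aeval (Sum.elim (fun x => Ideal.Quotient.mk _ (b x))
      (fun c => Ideal.Quotient.mk _ (MvPolynomial.X c)))
  have hf₂ : idealS d U P ≤ RingHom.ker f₂.toRingHom := by
    rw [idealS_le_ker_iff]
    have := (idealU_le_ker_iff hP (Ideal.Quotient.mk (idealU d U P)) hb).1 (by rw [Ideal.mk_ker])
    simpa [f₂] using this
  refine ⟨AlgEquiv.ofAlgHom (Ideal.Quotient.liftₐ _ f₁ fun a ha => hf₁ ha)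
    (Ideal.Quotient.liftₐ _ f₂ fun a ha => hf₂ ha) ?_ ?_, fun a => rfl⟩
  · refine Ideal.Quotient.algHom_ext _ (MvPolynomial.algHom_ext fun x => ?_)
    rcases x with x | c
    · have h1 : f₂ (MvPolynomial.X (Sum.inl x)) = Ideal.Quotient.mk _ (b x) := by simp [f₂]
      change Ideal.Quotient.liftₐ _ f₁ (fun a ha => hf₁ ha) (f₂ (MvPolynomial.X (Sum.inl x))) = _
      rw [h1]
      exact (congrFun hf₁b x).symm
    · have h1 : f₂ (MvPolynomial.X (Sum.inr c)) =
        Ideal.Quotient.mk _ (MvPolynomial.X c) := by simp [f₂]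
      change Ideal.Quotient.liftₐ _ f₁ (fun a ha => hf₁ ha) (f₂ (MvPolynomial.X (Sum.inr c))) = _
      rw [h1]
      exact hf₁X c
  · refine Ideal.Quotient.algHom_ext _ (MvPolynomial.algHom_ext fun c => ?_)
    change Ideal.Quotient.liftₐ _ f₂ (fun a ha => hf₂ ha) (f₁ (MvPolynomial.X c)) = _
    rw [hf₁X]
    change f₂ (MvPolynomial.X (Sum.inr c)) = _
    simp [f₂]

/-- This is the injectivity of the isomorphism of quotients induced by the inclusion. -/
lemma comap_idealS (hP : IsPommaretBasis U P) :
    (idealS d U P).comap (inclC d U P) = idealU d U P := by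
  obtain ⟨e, he⟩ := exists_quotient_algEquiv (d := d) hP
  ext a
  rw [Ideal.mem_comap, ← Ideal.Quotient.eq_zero_iff_mem, ← Ideal.Quotient.eq_zero_iff_mem, ← he,
    EmbeddingLike.map_eq_zero_iff]

lemma matrixZero_mul_matrixOne_apply {A : Type u} [CommRing A] (c : CParam d U P → A)
    (b : BParam K d P → A) (k : Fin m) (p : NonMult P) :
    (matrixZero d U P c * matrixOne K d P b : Matrix _ _ (PolyRing n A)) k p =
      partialZero (markedSet d U P c) (preSyz K d P b p) k := by
  simp [Matrix.mul_apply, matrixZero, matrixOne, partialZero_apply, mul_comm]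

lemma matrixZero_mul_matrixOne_eq_zero_iff {A : Type u} [CommRing A] (c : CParam d U P → A)
    (b : BParam K d P → A) :
    (matrixZero d U P c * matrixOne K d P b : Matrix _ _ (PolyRing n A)) = 0 ↔
      IsSyzSolution c b := by
  constructor
  · intro h p
    funext k
    rw [← matrixZero_mul_matrixOne_apply, h]
    rfl
  · intro h
    ext1 k p
    rw [matrixZero_mul_matrixOne_apply, h p]
    rfl

lemma idealS_eq_span_coeff_matrix :
    idealS d U P =
      Ideal.span {a | ∃ (k : Fin m) (p : NonMult P) (β : Mon n),
        a = MvPolynomial.coeff β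
          ((matrixZero d U P (fun c => MvPolynomial.X (Sum.inr c)) *
            matrixOne K d P (fun b => MvPolynomial.X (Sum.inl b)) :
            Matrix _ _ (PolyRing n (RingBC d U P))) k p)} := by
  rw [idealS]
  congr 1
  ext a
  constructor
  · rintro ⟨p, ⟨β, k⟩, rfl⟩
    exact ⟨k, p, β, congrArg (MvPolynomial.coeff β) (matrixZero_mul_matrixOne_apply _ _ k p).symm⟩
  · rintro ⟨k, p, β, rfl⟩
    exact ⟨p, (β, k), congrArg (MvPolynomial.coeff β) (matrixZero_mul_matrixOne_apply _ _ k p)⟩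

end ideals

/-! ### Points of affine schemes -/

section points

variable {K : Type u} [Field K] {Q Q' : Type u} [CommRing Q] [Algebra K Q] [CommRing Q']
  [Algebra K Q']

/-- `Spec` is fully faithful from the opposite category of `K`-algebras to `K`-schemes. -/
lemma algPoint_bijective (A : NoethAlg K) :
    Function.Bijective (algPoint (Q := Q) A) := by
  constructor
  · intro φ φ' h
    have h1 := (algSpec.fullyFaithful (R := CommRingCat.of K)).map_injective h
    have h2 := Quiver.Hom.op_inj h1
    exact congrArg CommAlgCat.Hom.hom h2
  · intro x
    obtain ⟨g, rfl⟩ := (algSpec.fullyFaithful (R := CommRingCat.of K)).map_surjective x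
    exact ⟨g.unop.hom, rfl⟩

lemma points_map_algPoint {A A' : NoethAlg K} (σ : A ⟶ A') (φ : Q →ₐ[K] A.obj) :
    (points (specOver K Q)).map σ (algPoint A φ) = algPoint A' (σ.hom.hom.comp φ) :=
  ((algSpec (CommRingCat.of K)).map_comp σ.hom.op (CommAlgCat.ofHom φ).op).symm

lemma pointsMap_algPoint (A : NoethAlg K) (ψ : Q' →ₐ[K] Q) (φ : Q →ₐ[K] A.obj) :
    (pointsMap (specOverMap ψ)).app A (algPoint A φ) = algPoint A (φ.comp ψ) :=
  ((algSpec (CommRingCat.of K)).map_comp (CommAlgCat.ofHom φ).op (CommAlgCat.ofHom ψ).op).symm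

/-- An isomorphism of `K`-algebras gives an isomorphism of their spectra. -/
def specOverIso (e : Q ≃ₐ[K] Q') : specOver K Q' ≅ specOver K Q where
  hom := specOverMap e.toAlgHom
  inv := specOverMap e.symm.toAlgHom
  hom_inv_id := by
    rw [← Functor.map_comp, ← op_comp, ← CommAlgCat.ofHom_comp]
    simp
  inv_hom_id := by
    rw [← Functor.map_comp, ← op_comp, ← CommAlgCat.ofHom_comp]
    simp

/-- A subfunctor is represented by `Spec Q` as soon as its elements correspond naturally and
bijectively to homomorphisms from `Q`. -/
lemma exists_points_iso {F : NoethAlg K ⥤ Type u} (G : Subfunctor F)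
    (Φ : ∀ A : NoethAlg K, (Q →ₐ[K] A.obj) → F.obj A)
    (hinj : ∀ A, Function.Injective (Φ A))
    (hrange : ∀ A, G.obj A = Set.range (Φ A))
    (hnat : ∀ (A A' : NoethAlg K) (σ : A ⟶ A') (φ : Q →ₐ[K] A.obj),
      F.map σ (Φ A φ) = Φ A' (σ.hom.hom.comp φ)) :
    ∃ e : points (specOver K Q) ≅ G.toFunctor,
      ∀ (A : NoethAlg K) (φ : Q →ₐ[K] A.obj), (e.hom.app A (algPoint A φ)).1 = Φ A φ := by
  let α (A : NoethAlg K) : (Q →ₐ[K] A.obj) ≃ (points (specOver K Q)).obj A :=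
    Equiv.ofBijective _ (algPoint_bijective A)
  let β (A : NoethAlg K) : (Q →ₐ[K] A.obj) ≃ G.obj A :=
    (Equiv.ofInjective _ (hinj A)).trans (Equiv.setCongr (hrange A).symm)
  have hαβ : ∀ A φ, (((α A).symm.trans (β A)) (algPoint A φ)).1 = Φ A φ := fun A φ => by
    have : (α A).symm (algPoint A φ) = φ := (α A).symm_apply_apply φ
    rw [Equiv.trans_apply, this]
    rfl
  refine ⟨NatIso.ofComponents (fun A => ((α A).symm.trans (β A)).toIso) ?_, hαβ⟩
  intro A A' σ
  refine ConcreteCategory.hom_ext _ _ fun x => ?_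
  obtain ⟨φ, rfl⟩ := (algPoint_bijective A).2 x
  refine Subtype.ext ?_
  change (((α A').symm.trans (β A')) ((points (specOver K Q)).map σ (algPoint A φ))).1 =
    F.map σ (((α A).symm.trans (β A)) (algPoint A φ)).1
  rw [points_map_algPoint, hαβ, hαβ, hnat]

end points

/-! ### The functors -/

section functors

variable {n m : ℕ} {K : Type u} [Field K] {d : Fin m → ℤ}
  {U : Submodule (PolyRing n K) (Vec n (Fin m) K)} {P : Finset (Term n (Fin m))}

/-- The `U`-marked functor. -/
def markedFunctor (d : Fin m → ℤ) (hP : IsPommaretBasis U P) :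
    Subfunctor (submoduleFunctor K n (Fin m)) where
  obj A := markedModules d U A
  map {A A'} σ M hM := by
    obtain ⟨c, b, h, rfl⟩ := (mem_markedModules_iff hP A M).1 hM
    exact (mem_markedModules_iff hP A' _).2 ⟨_, _, h.map σ.hom.hom.toRingHom,
      (extendScalars_markedSet _ c).symm⟩

/-- The `U`-marked syzygy functor. -/
def markedSyzygyFunctor (d : Fin m → ℤ) (hP : IsPommaretBasis U P) :
    Subfunctor (pairFunctor K n (Fin m) P) where
  obj A := markedSyzygies d U P A
  map {A A'} σ M hM := by
    obtain ⟨c, b, h, rfl⟩ := (mem_markedSyzygies_iff hP A M).1 hM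
    exact (mem_markedSyzygies_iff hP A' _).2 ⟨_, _, h.map σ.hom.hom.toRingHom,
      Prod.ext (extendScalars_markedSet _ c).symm (extendScalars_preSyz _ b).symm⟩

/-- A solution `c`, `b` defines a homomorphism from `K[B, C] / 𝒮`. -/
lemma IsSyzSolution.exists_algHom {A : Type u} [CommRing A] [Algebra K A] {c : CParam d U P → A}
    {b : BParam K d P → A} (h : IsSyzSolution c b) :
    ∃ φ : (RingBC d U P ⧸ idealS d U P) →ₐ[K] A,
      (∀ x, φ (Ideal.Quotient.mk _ (MvPolynomial.X (Sum.inr x))) = c x) ∧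
      ∀ x, φ (Ideal.Quotient.mk _ (MvPolynomial.X (Sum.inl x))) = b x := by
  let f : RingBC d U P →ₐ[K] A := MvPolynomial.aeval (Sum.elim b c)
  have hf : idealS d U P ≤ RingHom.ker f.toRingHom := by
    rw [idealS_le_ker_iff]
    simpa [f] using h
  refine ⟨Ideal.Quotient.liftₐ _ f fun a ha => hf ha, fun x => ?_, fun x => ?_⟩
  · change f (MvPolynomial.X (Sum.inr x)) = c x
    simp [f]
  · change f (MvPolynomial.X (Sum.inl x)) = b x
    simp [f]

lemma isSyzSolution_of_algHom {A : Type u} [CommRing A] [Algebra K A]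
    (φ : (RingBC d U P ⧸ idealS d U P) →ₐ[K] A) :
    IsSyzSolution (d := d) (U := U) (P := P)
      (fun c => φ (Ideal.Quotient.mk _ (MvPolynomial.X (Sum.inr c))))
      (fun b => φ (Ideal.Quotient.mk _ (MvPolynomial.X (Sum.inl b)))) :=
  ((idealS_le_ker_iff (Ideal.Quotient.mk (idealS d U P))).1 (by rw [Ideal.mk_ker])).map φ.toRingHom

/-- Only the first modules need to agree, because they already determine the values of `C` and of
`B`. -/
lemma algHom_ext_of_span_eq (hP : IsPommaretBasis U P) {A : Type u} [CommRing A] [Algebra K A]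
    {φ φ' : (RingBC d U P ⧸ idealS d U P) →ₐ[K] A}
    (h : Submodule.span (PolyRing n A) (Set.range (markedSet d U P
        fun c => φ (Ideal.Quotient.mk _ (MvPolynomial.X (Sum.inr c))))) =
      Submodule.span (PolyRing n A) (Set.range (markedSet d U P
        fun c => φ' (Ideal.Quotient.mk _ (MvPolynomial.X (Sum.inr c)))))) : φ = φ' := by
  obtain ⟨hc, hb⟩ := (isSyzSolution_of_algHom φ).eq_of_span_eq hP (isSyzSolution_of_algHom φ') h
  refine Ideal.Quotient.algHom_ext _ (MvPolynomial.algHom_ext fun x => ?_)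
  rcases x with x | x
  · exact congrFun hb x
  · exact congrFun hc x

end functors

end

end MarkedSyz

/-! ### The representability theorem -/

theorem mainTheorem8 {K : Type u} [Field K] {n m : ℕ} (d : Fin m → ℤ)
    (U : Submodule (PolyRing n K) (Vec n (Fin m) K))
    (P : Finset (Term n (Fin m))) (hP : IsPommaretBasis U P) :
    -- the `U`-marked functor `Mf` and the `U`-marked syzygy functor `Sf`
    (∃ (Mf : Subfunctor (submoduleFunctor K n (Fin m)))
      (Sf : Subfunctor (pairFunctor K n (Fin m) P)),
      (∀ A, Mf.obj A = markedModules d U A) ∧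
      (∀ A, Sf.obj A = markedSyzygies d U P A) ∧
      -- they are represented by `Spec (K[C] / 𝒰)` and `Spec (K[B, C] / 𝒮)`
      ∃ (e : points (syzScheme d U P) ≅ Sf.toFunctor)
        (f : points (mfScheme d U P) ≅ Mf.toFunctor)
        (pr : syzScheme d U P ≅ mfScheme d U P),
        (∀ (A : NoethAlg K)
          (φ : (RingBC d U P ⧸ idealS d U P) →ₐ[K] A.obj),
          (e.hom.app A (algPoint A φ)).1 =
            (Submodule.span (PolyRing n A.obj) (Set.range (markedSet d U P
                fun c => φ (Ideal.Quotient.mk _ (MvPolynomial.X (Sum.inr c))))),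
              Submodule.span (PolyRing n A.obj) (Set.range (preSyz K d P
                fun b => φ (Ideal.Quotient.mk _ (MvPolynomial.X (Sum.inl b))))))) ∧
        (∀ (A : NoethAlg K)
          (ψ : (RingC d U P ⧸ idealU d U P) →ₐ[K] A.obj),
          (f.hom.app A (algPoint A ψ)).1 =
            Submodule.span (PolyRing n A.obj) (Set.range (markedSet d U P
              fun c => ψ (Ideal.Quotient.mk _ (MvPolynomial.X c))))) ∧
        -- the projection to the `C`-coordinates restricts to the isomorphism `pr`,
        -- which corresponds to `(M, S) ↦ M`
        pr.hom ≫ mfImmersion d U P =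
          syzImmersion d U P ≫ projC d U P ∧
        (∀ (A : NoethAlg K)
          (x : (points (syzScheme d U P)).obj A),
          (f.hom.app A ((pointsMap pr.hom).app A x)).1 = (e.hom.app A x).1.1)) ∧
    -- `𝒮` is generated by the coefficients of the entries of `M₀ M₁`
    idealS d U P =
      Ideal.span {a | ∃ (k : Fin m) (p : NonMult P) (β : Mon n),
        a = MvPolynomial.coeff β
          ((matrixZero d U P (fun c => MvPolynomial.X (Sum.inr c)) *
            matrixOne K d P (fun b => MvPolynomial.X (Sum.inl b)) :
            Matrix _ _ (PolyRing n (RingBC d U P))) k p)} ∧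
    -- for values of the parameters in a Noetherian `K`-algebra, `M₀ M₁ = 0` holds if and only if
    -- `𝓕` becomes a marked basis and the pre-syzygies become its fundamental syzygies
    (∀ (A : Type u) [CommRing A] [IsNoetherianRing A] [Algebra K A]
      (φ : RingBC d U P →ₐ[K] A),
      (idealS d U P ≤ RingHom.ker φ ↔
        matrixZero d U P (fun c => φ (MvPolynomial.X (Sum.inr c))) *
          matrixOne K d P (fun b => φ (MvPolynomial.X (Sum.inl b))) = 0) ∧
      (matrixZero d U P (fun c => φ (MvPolynomial.X (Sum.inr c))) *
          matrixOne K d P (fun b => φ (MvPolynomial.X (Sum.inl b))) = 0 ↔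
        IsMarkedBasis d U P
            (markedSet d U P fun c => φ (MvPolynomial.X (Sum.inr c))) ∧
          ∀ p : NonMult P, IsFundamentalSyzygy
            (markedSet d U P fun c => φ (MvPolynomial.X (Sum.inr c))) p
            (preSyz K d P (fun b => φ (MvPolynomial.X (Sum.inl b))) p))) ∧
    -- `𝒮 ∩ K[C] = 𝒰`
    (idealS d U P).comap (inclC d U P) = idealU d U P := by
  obtain ⟨ε, hε⟩ := exists_quotient_algEquiv (d := d) hP
  have hεX : ∀ c, ε (Ideal.Quotient.mk _ (MvPolynomial.X c)) =
      Ideal.Quotient.mk _ (MvPolynomial.X (Sum.inr c)) := fun c => by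
    rw [hε, inclC, MvPolynomial.rename_X]
  refine ⟨⟨markedFunctor d hP, markedSyzygyFunctor d hP, fun _ => rfl, fun _ => rfl, ?_⟩,
    idealS_eq_span_coeff_matrix, fun A _ _ _ φ => ⟨?_, ?_⟩, comap_idealS hP⟩
  · obtain ⟨e, he⟩ := exists_points_iso (Q := RingBC d U P ⧸ idealS d U P)
      (markedSyzygyFunctor d hP)
      (fun A φ => (Submodule.span (PolyRing n A.obj) (Set.range (markedSet d U P
          fun c => φ (Ideal.Quotient.mk _ (MvPolynomial.X (Sum.inr c))))),
        Submodule.span (PolyRing n A.obj) (Set.range (preSyz K d P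
          fun b => φ (Ideal.Quotient.mk _ (MvPolynomial.X (Sum.inl b)))))))
      (fun A φ φ' h => algHom_ext_of_span_eq hP (Prod.ext_iff.1 h).1)
      (fun A => Set.ext fun x => (mem_markedSyzygies_iff hP A x).trans ⟨fun ⟨c, b, h, hx⟩ => by
          obtain ⟨φ, hc, hb⟩ := h.exists_algHom
          refine ⟨φ, ?_⟩
          simp only [hc, hb]
          exact hx,
        fun ⟨φ, hφ⟩ => ⟨_, _, isSyzSolution_of_algHom φ, hφ⟩⟩)
      (fun A A' σ φ => Prod.ext (extendScalars_markedSet _ _) (extendScalars_preSyz _ _))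
    obtain ⟨f, hf⟩ := exists_points_iso (Q := RingC d U P ⧸ idealU d U P)
      (markedFunctor d hP)
      (fun A ψ => Submodule.span (PolyRing n A.obj) (Set.range (markedSet d U P
          fun c => ψ (Ideal.Quotient.mk _ (MvPolynomial.X c)))))
      -- Homomorphisms from `K[C]/𝒰` are transported along `ε` to homomorphisms from `K[B,C]/𝒮`,
      -- where injectivity is known.
      (fun A ψ ψ' h => by
        have hcomp : ψ.comp ε.symm.toAlgHom = ψ'.comp ε.symm.toAlgHom := by
          refine algHom_ext_of_span_eq hP ?_
          simp only [AlgHom.comp_apply, ← hεX]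
          simpa using (show Submodule.span _ _ = Submodule.span _ _ from h)
        refine AlgHom.ext fun a => ?_
        simpa using DFunLike.congr_fun hcomp (ε a))
      (fun A => Set.ext fun M => (mem_markedModules_iff hP A M).trans ⟨fun ⟨c, b, h, hx⟩ => by
          obtain ⟨φ, hc, -⟩ := h.exists_algHom
          refine ⟨φ.comp ε.toAlgHom, ?_⟩
          refine Eq.trans ?_ hx
          simp [hεX, hc]
          rfl,
        fun ⟨ψ, hψ⟩ => ⟨_, _, isSyzSolution_of_algHom (ψ.comp ε.symm.toAlgHom), by
          refine Eq.trans ?_ hψ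
          simp [← hεX]⟩⟩)
      (fun A A' σ ψ => extendScalars_markedSet _ _)
    refine ⟨e, f, specOverIso ε, he, hf, ?_, fun A x => ?_⟩
    · change specOverMap ε.toAlgHom ≫ specOverMap (Ideal.Quotient.mkₐ K (idealU d U P)) =
        specOverMap (Ideal.Quotient.mkₐ K (idealS d U P)) ≫ specOverMap (inclC d U P)
      -- On algebras, both composites are maps `K[C] → K[B,C]/𝒮`, and they agree because `ε` is
      -- induced by the inclusion.
      rw [← Functor.map_comp, ← Functor.map_comp, ← op_comp, ← op_comp, ← CommAlgCat.ofHom_comp,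
        ← CommAlgCat.ofHom_comp]
      congr 3
      exact AlgHom.ext hε
    · obtain ⟨φ, rfl⟩ := (algPoint_bijective A).2 x
      have h1 : (pointsMap (specOverIso ε).hom).app A (algPoint A φ) =
          algPoint A (φ.comp ε.toAlgHom) := pointsMap_algPoint A ε.toAlgHom φ
      refine (congrArg (fun y => (f.hom.app A y).1) h1).trans ((hf A _).trans
        (Eq.trans ?_ (congrArg Prod.fst (he A φ)).symm))
      simp [hεX]
      rfl
  · exact (idealS_le_ker_iff φ.toRingHom).trans (matrixZero_mul_matrixOne_eq_zero_iff _ _).symm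
  · refine (matrixZero_mul_matrixOne_eq_zero_iff _ _).trans ⟨fun h => ?_, fun h p => ?_⟩
    · exact ⟨isMarkedBasis_of_isCompl hP (h.isCompl hP), h.isFundamentalSyzygy⟩
    · exact partialZero_eq_zero_of_isFundamentalSyzygy (h.2 p)
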